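/- \textbf{Setting.} Let $C$ be the number of classes, $[C]=\{1,\dots,C\}$, let $\mathcal X\subseteq\mathbb R^p$ satisfy $\|x\|\le B$ for all $x\in\mathcal X$, and consider $R$ annotators. For $j\in[R]$ let $D_I^j$ be a probability distribution of data points $(x,\bar y,y^\star)$ with $x\in\mathcal X$ almost surely, where $\bar y\in[C]$ is the noisy label given by annotator $j$ and $y^\star\in[C]$ is the Bayes optimal label; let $m_j\ge1$. Fix layer widths and activation functions $\sigma_1,\dots,\sigma_{d-1}:\mathbb R\to\mathbb R$ ($d\ge1$) that are $1$-Lipschitz and positive-homogeneous ($\sigma(au)=a\sigma(u)$ for $a>0$). For weight matrices $W=(W_1,\dots,W_d)$ let $$t(x)=W_d\,\sigma_{d-1}(W_{d-1}\,\sigma_{d-2}(\cdots\sigma_1(W_1x)))\in\mathbb R^{C\times C},$$ with the activations applied element-wise, and let $T(x)\in\mathbb R^{C\times C}$ be the row-wise softmax, $T_{ab}(x)=\exp(t_{ab}(x))/\sum_{k=1}^C\exp(t_{ak}(x))$. Let $\mathcal T$ be the class of all $T$ obtained from weights whose Frobenius norms satisfy $\|W_i\|_F\le M_i$ for $i=1,\dots,d$.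 With $\bar{\boldsymbol y},\boldsymbol y^\star$ the one-hot row vectors of $\bar y,y^\star$ and $\ell(p,q)=-\sum_{c} p_c\log q_c$ the cross-entropy, assume $\ell(\bar{\boldsymbol y},\boldsymbol y^\star\cdot T(x))\le M$ for all $T\in\mathcal T$, $x\in\mathcal X$ and all labels. Put $$\mathcal R_{D_I^j}(T)=\mathbb E_{(x,\bar y,y^\star)\sim D_I^j}\,\ell(\bar{\boldsymbol y},\boldsymbol y^\star\cdot T(x)),\qquad \hat{\mathcal R}_{\mathcal D}(T)=\frac1{m_j}\sum_{(x,\bar y,y^\star)\in\mathcal D}\ell(\bar{\boldsymbol y},\boldsymbol y^\star\cdot T(x))$$ for a data set $\mathcal D$ of size $m_j$. \textbf{Theorem 1.} Let $j\in[R]$ and $\delta\in(0,1)$, and let $\mathcal D_I^j$ consist of $m_j$ independent draws from $D_I^j$. Then with probability at least $1-\delta$, simultaneously for all $T\in\mathcal T$ (in particular for the transition matrix $\hat T^j$ learned from $\mathcal D_I^j$), $$\mathcal R_{D_I^j}(T)-\hat{\mathcal R}_{\mathcal D_I^j}(T)\le\frac{2C^2B(\sqrt{2d\log2}+1)\prod_{i=1}^dM_i}{\sqrt{Cm_j}}+M\sqrt{\frac{\log(1/\delta)}{2m_j}}.$$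 Moreover, if $C$ divides $m_j$ and $y^\star$ is uniformly distributed on $[C]$ under $D_I^j$, the same holds with probability at least $1-\delta$ conditionally on $\mathcal D_I^j$ being class-balanced, that is, on each class occurring exactly $m_j/C$ times among the labels $y^\star$ of $\mathcal D_I^j$. -/

import Mathlib

open MeasureTheory ProbabilityTheory
open scoped Matrix Matrix.Norms.Frobenius ENNReal

noncomputable section

namespace Crowds

/-- A data point `(x, ȳ, y⋆)`: an instance `x` in Euclidean space, the noisy label `ȳ` given by the
annotator, and the Bayes optimal label `y⋆`; there are `C` classes. -/
abbrev DataPoint (p C : ℕ) : Type := EuclideanSpace ℝ (Fin p) × Fin C × Fin C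

/-- The weight matrices of a network with `L` hidden layers, that is, of `d = L + 1` layers.
`h 0` is the input dimension and `h i` the width of the `i`-th hidden layer, `1 ≤ i ≤ L`.
`hidden i` is `W_{i+1}`; `output` is `W_d`, with values in the `C × C` arrays. -/
structure Weights (C L : ℕ) (h : ℕ → ℕ) where
  hidden : (i : Fin L) → Matrix (Fin (h (i + 1))) (Fin (h i)) ℝ
  output : Matrix (Fin C × Fin C) (Fin (h L)) ℝ

variable {C L : ℕ} {h : ℕ → ℕ}

/-- `M` bounds the Frobenius norms of the `d = L + 1` weight matrices, layer by layer. -/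
def Weights.FrobeniusBounded (W : Weights C L h) (M : Fin (L + 1) → ℝ) : Prop :=
  (∀ i : Fin L, ‖W.hidden i‖ ≤ M i.castSucc) ∧ ‖W.output‖ ≤ M (Fin.last L)

/-- The output of the `i`-th hidden layer (for `i = 0`, the input), with activation functions
applied element-wise: `σ_i (W_i σ_{i-1} (… σ_1 (W_1 x)))`. -/
def Weights.feature (W : Weights C L h) (σ : Fin L → ℝ → ℝ) (x : EuclideanSpace ℝ (Fin (h 0))) :
    (i : ℕ) → i ≤ L → Fin (h i) → ℝ
  | 0, _ => fun r => x r
  | i + 1, hi => fun r =>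
      σ ⟨i, hi⟩ ((W.hidden ⟨i, hi⟩ *ᵥ W.feature σ x i (Nat.le_of_succ_le hi)) r)

/-- The network `t(x) = W_d σ_{d-1} (W_{d-1} σ_{d-2} (… σ_1 (W_1 x)))`, a `C × C` array. -/
def Weights.net (W : Weights C L h) (σ : Fin L → ℝ → ℝ) (x : EuclideanSpace ℝ (Fin (h 0))) :
    Matrix (Fin C) (Fin C) ℝ :=
  Matrix.of fun a b => (W.output *ᵥ W.feature σ x L le_rfl) (a, b)

/-- The transition matrix `T(x)`: the softmax of each row of `t(x)`. -/
def Weights.transition (W : Weights C L h) (σ : Fin L → ℝ → ℝ)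
    (x : EuclideanSpace ℝ (Fin (h 0))) : Matrix (Fin C) (Fin C) ℝ :=
  Matrix.of fun a b => Real.exp (W.net σ x a b) / ∑ k, Real.exp (W.net σ x a k)

/-- The one-hot vector of a label. -/
def oneHot (y : Fin C) : Fin C → ℝ := Pi.single y 1

/-- The cross-entropy of a predicted distribution `q` with respect to a target `p`. -/
def crossEntropy (p q : Fin C → ℝ) : ℝ := -∑ c, p c * Real.log (q c)

/-- The loss `ℓ(ȳ, y⋆ · T(x))` of the transition matrix at a data point `(x, ȳ, y⋆)`. -/
def Weights.loss (W : Weights C L h) (σ : Fin L → ℝ → ℝ) (z : DataPoint (h 0) C) : ℝ :=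
  crossEntropy (oneHot z.2.1) (oneHot z.2.2 ᵥ* W.transition σ z.1)

/-- The expected risk under the distribution `D`. -/
def Weights.risk (W : Weights C L h) (σ : Fin L → ℝ → ℝ) (D : Measure (DataPoint (h 0) C)) : ℝ :=
  ∫ z, W.loss σ z ∂D

/-- The empirical risk on a data set `S` of size `m`. -/
def Weights.empiricalRisk (W : Weights C L h) (σ : Fin L → ℝ → ℝ) {m : ℕ}
    (S : Fin m → DataPoint (h 0) C) : ℝ :=
  (∑ i, W.loss σ (S i)) / m

/-- The data set `S` is class-balanced with respect to `y⋆`: each of the `C` classes occurs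
exactly `m / C` times. -/
def ClassBalanced {p m : ℕ} (S : Fin m → DataPoint p C) : Prop :=
  ∀ k : Fin C, C * (Finset.univ.filter fun i => (S i).2.2 = k).card = m

/-- The right-hand side of the generalization bound, for `C` classes, inputs bounded by `B`,
`d` layers with Frobenius bounds `Mw`, loss bound `M`, sample size `m`, confidence `1 - δ`. -/
def genBound (C : ℕ) (B : ℝ) {d : ℕ} (Mw : Fin d → ℝ) (M : ℝ) (m : ℕ) (δ : ℝ) : ℝ :=
  2 * (C : ℝ) ^ 2 * B * (√(2 * d * Real.log 2) + 1) * (∏ i, Mw i) / √((C : ℝ) * m)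
    + M * √(Real.log (1 / δ) / (2 * m))

end Crowds

end

/-! McDiarmid's inequality and symmetrization reduce the claim to the Rademacher average of the loss
class on a fixed sample with inputs of norm at most `B`. Suprema over networks are written with
selectors, that is, functions from sign patterns to parameters: each selector on the left of a
comparison is dominated by one on the right, so boundedness of suprema never enters.

The loss is log-sum-exp minus one coordinate of a row of `t(x)`, hence 2-Lipschitz in the sup norm
of that row. Vector contraction (`exists_selector_vector_contraction`) replaces it by twice the
correlation of the `C` entries of the row with `C` fresh signs.

For the network, layers are peeled off inside an exponential moment (`sum_cosh_norm_feature_le`):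
homogeneity reduces a layer to one normalized row, and scalar contraction removes the activation.
Each hidden layer costs a factor 2, which the logarithm turns into a summand `log 2`. The moment
used is that of the cosh of a norm: it is sub-Gaussian without a dimension factor
(`sum_cosh_norm_le`), and convexity of `cosh ∘ √` turns it into a bound on second moments. These add
up over the `C²` output entries, and each of the `C m` signs meets only one entry, whence `√(C m)`.
The average obtained, `2 √(2 d log 2) B ∏ M_i √(C m)`, is within the claim for `C ≥ 2`; for `C = 1`
the loss vanishes.

Given its labels, a class-balanced sample consists of independent draws from class-conditional
distributions, whose mean is `D` when classes are equally likely. All probabilistic lemmas therefore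
allow non-identical draws, and the conditional law is a mixture of such products. They treat finite
families of networks; a dense sequence gives the whole class. -/

namespace Crowds

/-! ### Selectors and contraction principles for random signs -/

/-- The value `±1` of a sign. -/
def signVal (b : Bool) : ℝ := if b then 1 else -1

@[simp] lemma signVal_true : signVal true = 1 := rfl

@[simp] lemma signVal_false : signVal false = -1 := rfl

@[simp] lemma signVal_not (b : Bool) : signVal (!b) = -signVal b := by
  cases b <;> simp

lemma sum_fin_succ_arrow {γ : Type*} [Fintype γ] {n : ℕ} (f : (Fin (n + 1) → γ) → ℝ) :
    ∑ ε, f ε = ∑ e, ∑ ε : Fin n → γ, f (Fin.cons e ε) := by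
  rw [← Fintype.sum_prod_type', ← (Fin.consEquiv (fun _ => γ)).sum_comp]
  rfl

/-- A comparison of maxima over `Θ`, written with selectors, passes from one coordinate to a
product: the case of one coordinate is `step`. -/
theorem exists_selector_sum_le {Θ α β : Type*} [Fintype α] [Fintype β] (g : ℝ → ℝ) {n : ℕ}
    (p : Fin n → α → Θ → ℝ) (q : Fin n → β → Θ → ℝ)
    (step : ∀ i (A : Θ → ℝ) (t : α → Θ), ∃ t' : β → Θ,
      (Fintype.card β : ℝ) * ∑ e, g (A (t e) + p i e (t e)) ≤
        Fintype.card α * ∑ e, g (A (t' e) + q i e (t' e)))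
    (A : Θ → ℝ) (t : (Fin n → α) → Θ) :
    ∃ t' : (Fin n → β) → Θ,
      (Fintype.card β : ℝ) ^ n * ∑ ε, g (A (t ε) + ∑ i, p i (ε i) (t ε)) ≤
        (Fintype.card α : ℝ) ^ n * ∑ ε, g (A (t' ε) + ∑ i, q i (ε i) (t' ε)) := by
  induction n generalizing A with
  | zero => exact ⟨fun _ => t Fin.elim0, by
      simp only [pow_zero, Finset.univ_eq_empty, Finset.sum_empty]
      have h : ∀ ε : Fin 0 → α, t ε = t Fin.elim0 := fun ε => congrArg t (Subsingleton.elim _ _)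
      simp [h]⟩
  | succ n ih =>
    -- For fixed first coordinate `e`, its term is absorbed into the offset `A` and the tail is
    -- exchanged; then, for fixed new tail `η`, the first coordinate is exchanged by `step`.
    have h1 : ∀ e : α, ∃ t' : (Fin n → β) → Θ, _ := fun e =>
      ih (fun i => p i.succ) (fun i => q i.succ) (fun i => step i.succ)
        (fun θ => A θ + p 0 e θ) (fun ε => t (Fin.cons e ε))
    choose t1 ht1 using h1
    have h2 : ∀ η : Fin n → β, ∃ t' : β → Θ, _ := fun η =>
      step 0 (fun θ => A θ + ∑ i, q i.succ (η i) θ) (fun e => t1 e η)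
    choose t2 ht2 using h2
    refine ⟨fun η => t2 (Fin.tail η) (η 0), ?_⟩
    rw [sum_fin_succ_arrow, sum_fin_succ_arrow]
    simp only [Fin.sum_univ_succ, Fin.cons_zero, Fin.cons_succ, Fin.tail_cons, ← add_assoc]
    rw [Finset.sum_comm (s := (Finset.univ : Finset β))]
    calc (Fintype.card β : ℝ) ^ (n + 1) * ∑ e, ∑ ε : Fin n → α,
            g (A (t (Fin.cons e ε)) + p 0 e (t (Fin.cons e ε)) +
              ∑ i : Fin n, p i.succ (ε i) (t (Fin.cons e ε)))
        = Fintype.card β * ∑ e, (Fintype.card β : ℝ) ^ n * ∑ ε : Fin n → α,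
            g (A (t (Fin.cons e ε)) + p 0 e (t (Fin.cons e ε)) +
              ∑ i : Fin n, p i.succ (ε i) (t (Fin.cons e ε))) := by
          rw [pow_succ', mul_assoc, Finset.mul_sum]
      _ ≤ Fintype.card β * ∑ e, (Fintype.card α : ℝ) ^ n * ∑ η : Fin n → β,
            g (A (t1 e η) + p 0 e (t1 e η) + ∑ i : Fin n, q i.succ (η i) (t1 e η)) := by
          refine mul_le_mul_of_nonneg_left (Finset.sum_le_sum fun e _ => ht1 e) (by positivity)
      _ = (Fintype.card α : ℝ) ^ n * ∑ η : Fin n → β, (Fintype.card β * ∑ e,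
            g (A (t1 e η) + ∑ i : Fin n, q i.succ (η i) (t1 e η) + p 0 e (t1 e η))) := by
          rw [← Finset.mul_sum, Finset.sum_comm, ← Finset.mul_sum, mul_left_comm]
          simp only [add_right_comm]
      _ ≤ (Fintype.card α : ℝ) ^ n * ∑ η : Fin n → β, (Fintype.card α * ∑ e,
            g (A (t2 η e) + ∑ i : Fin n, q i.succ (η i) (t2 η e) + q 0 e (t2 η e))) := by
          refine mul_le_mul_of_nonneg_left (Finset.sum_le_sum fun η _ => ht2 η) (by positivity)
      _ = _ := by
          rw [← Finset.mul_sum, pow_succ, mul_assoc]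
          simp only [add_right_comm]

/-- Flipping all signs except the one at `b` is a bijection of sign patterns, and the two sums so
paired add up to `±2 v b`. -/
lemma card_mul_abs_le_sum_abs {κ : Type*} [Fintype κ] [DecidableEq κ] (v : κ → ℝ) (b : κ) :
    (2 : ℝ) ^ Fintype.card κ * |v b| ≤ ∑ η : κ → Bool, |∑ c, signVal (η c) * v c| := by
  let f : (κ → Bool) → (κ → Bool) := fun η c => if c = b then η c else !η c
  have hf : Function.Involutive f := by
    intro η; ext c; by_cases h : c = b <;> simp [f, h]
  have key : ∀ η : κ → Bool,
      2 * |v b| ≤ |∑ c, signVal (η c) * v c| + |∑ c, signVal (f η c) * v c| := by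
    intro η
    refine le_trans (le_of_eq ?_) (abs_add_le _ _)
    rw [← Finset.sum_add_distrib, Finset.sum_eq_single b]
    · cases h : η b <;> simp [f, h, ← two_mul, abs_mul]
    · intro c _ hc; simp [f, hc]
    · simp
  have h1 := Finset.sum_le_sum (s := Finset.univ) fun η _ => key η
  rw [Finset.sum_add_distrib] at h1
  have h2 : ∑ η, |∑ c, signVal (f η c) * v c| = ∑ η : κ → Bool, |∑ c, signVal (η c) * v c| :=
    Equiv.sum_comp (Function.Involutive.toPerm f hf) (fun η => |∑ c, signVal (η c) * v c|)
  rw [h2] at h1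
  simp at h1
  linarith

lemma sum_comp_not {κ : Type*} [Fintype κ] [DecidableEq κ] {E : Type*} [AddCommMonoid E]
    (f : (κ → Bool) → E) : ∑ η : κ → Bool, f (fun c => !η c) = ∑ η, f η := by
  have hf : Function.Involutive (fun (η : κ → Bool) c => !η c) := by intro η; ext c; simp
  exact Equiv.sum_comp hf.toPerm f

/-- For each `η` the better of the two given parameters is selected. The patterns `η` and `-η`
together then yield at least both offsets plus `2 |∑ η_c Δ_c|`, where `Δ` is the difference of the
two vectors. By `card_mul_abs_le_sum_abs` the mean of `|∑ η_c Δ_c|` is at least the largest `|Δ_b|`,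
which controls the change of `ψ`. -/
theorem exists_selector_vector_contraction {Θ κ : Type*} [Fintype κ] [DecidableEq κ] [Nonempty κ]
    (ψ : Θ → ℝ) (u : Θ → κ → ℝ)
    (hψ : ∀ θ θ' r, (∀ b, |u θ b - u θ' b| ≤ r) → |ψ θ - ψ θ'| ≤ 2 * r)
    (A : Θ → ℝ) (t : Bool → Θ) :
    ∃ t' : (κ → Bool) → Θ,
      (2 : ℝ) ^ Fintype.card κ * ∑ e, (A (t e) + signVal e * ψ (t e)) ≤
        2 * ∑ η, (A (t' η) + 2 * ∑ b, signVal (η b) * u (t' η) b) := by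
  classical
  let F : (κ → Bool) → Θ → ℝ := fun η θ => A θ + 2 * ∑ b, signVal (η b) * u θ b
  let t' : (κ → Bool) → Θ := fun η =>
    if F η (t false) ≤ F η (t true) then t true else t false
  have ht : ∀ η, F η (t true) ≤ F η (t' η) := by
    intro η; by_cases h : F η (t false) ≤ F η (t true)
    · simp [t', h]
    · simp only [t', h, if_false]; exact (not_le.1 h).le
  have hf : ∀ η, F η (t false) ≤ F η (t' η) := by
    intro η; by_cases h : F η (t false) ≤ F η (t true)
    · simp only [t', h, if_true]
    · simp [t', h]
  refine ⟨t', ?_⟩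
  change _ ≤ 2 * ∑ η, F η (t' η)
  obtain ⟨b, -, hb⟩ := Finset.exists_max_image Finset.univ
    (fun b => |u (t true) b - u (t false) b|) Finset.univ_nonempty
  have hψb := hψ (t true) (t false) _ fun c => hb c (Finset.mem_univ c)
  have hneg : ∀ (η : κ → Bool) θ, F (fun c => !η c) θ = A θ - 2 * ∑ b, signVal (η b) * u θ b := by
    intro η θ; simp [F, sub_eq_add_neg]
  have hpair : ∀ η : κ → Bool, A (t true) + A (t false) +
      2 * |∑ c, signVal (η c) * (u (t true) c - u (t false) c)| ≤
        F η (t' η) + F (fun c => !η c) (t' fun c => !η c) := by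
    intro η
    have a1 := ht η
    have a2 := hf η
    have a3 := ht (fun c => !η c)
    have a4 := hf (fun c => !η c)
    rw [hneg η (t true)] at a3
    rw [hneg η (t false)] at a4
    simp only [mul_sub, Finset.sum_sub_distrib]
    simp only [F] at a1 a2
    rcases abs_cases (∑ c, signVal (η c) * u (t true) c - ∑ c, signVal (η c) * u (t false) c)
      with h | h <;> rw [h.1] <;> simp only [F] at * <;> linarith
  have h1 := Finset.sum_le_sum (s := Finset.univ) fun η _ => hpair η
  rw [Finset.sum_add_distrib, Finset.sum_add_distrib, Finset.sum_add_distrib,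
    sum_comp_not (fun η => F η (t' η)), ← Finset.mul_sum] at h1
  have h2 := card_mul_abs_le_sum_abs (fun c => u (t true) c - u (t false) c) b
  have h3 := (le_abs_self _).trans hψb
  simp only [Finset.sum_const, Finset.card_univ, Fintype.card_pi, Fintype.card_bool,
    Finset.prod_const, nsmul_eq_mul] at h1
  push_cast at h1
  simp only [Fintype.sum_bool, signVal_true, signVal_false]
  have h4 : (2 : ℝ) ^ Fintype.card κ * (ψ (t true) - ψ (t false)) ≤
      2 ^ Fintype.card κ * (2 * |u (t true) b - u (t false) b|) := by gcongr
  linarith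

lemma exp_sub_exp_le {a b a' b' : ℝ} (hab : b ≤ a) (hb : b ≤ b') (h : a - b ≤ a' - b') :
    Real.exp a - Real.exp b ≤ Real.exp a' - Real.exp b' := by
  have e1 : Real.exp a - Real.exp b = Real.exp b * (Real.exp (a - b) - 1) := by
    rw [mul_sub, ← Real.exp_add]; simp
  have e2 : Real.exp a' - Real.exp b' = Real.exp b' * (Real.exp (a' - b') - 1) := by
    rw [mul_sub, ← Real.exp_add]; simp
  rw [e1, e2]
  have : 1 ≤ Real.exp (a - b) := Real.one_le_exp (by linarith)
  have := Real.exp_pos b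
  gcongr

/-- The hypotheses say that the unprimed point is the better one for the sign `+` and the primed one
for `-`. If `b` and `b'` have opposite signs, monotonicity suffices term by term; otherwise an
increment of `exp` is compared with one that is at least as long and starts at least as high. -/
lemma exp_add_exp_contraction {a b p a' b' p' : ℝ} (hpp : |p - p'| ≤ |b - b'|) (hp : |p| ≤ |b|)
    (hp' : |p'| ≤ |b'|) (h1 : a' + p' ≤ a + p) (h2 : a - p ≤ a' - p') :
    Real.exp (a + p) + Real.exp (a' - p') ≤ Real.exp (a + b) + Real.exp (a' - b') ∨
      Real.exp (a + p) + Real.exp (a' - p') ≤ Real.exp (a' + b') + Real.exp (a - b) := by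
  rw [abs_le] at hpp hp hp'
  rcases le_total 0 b with hb | hb <;> rcases le_total 0 b' with hb' | hb'
  · rw [abs_of_nonneg hb] at hp
    rw [abs_of_nonneg hb'] at hp'
    rcases le_total b' b with hbb | hbb
    · left
      rw [abs_of_nonneg (sub_nonneg.2 hbb)] at hpp
      have := exp_sub_exp_le (a := a' - p') (b := a' - b') (a' := a + b) (b' := a + p)
        (by linarith) (by linarith) (by linarith)
      linarith
    · right
      rw [abs_of_nonpos (sub_nonpos.2 hbb)] at hpp
      have := exp_sub_exp_le (a := a + p) (b := a - b) (a' := a' + b') (b' := a' - p')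
        (by linarith) (by linarith) (by linarith)
      linarith
  · left
    rw [abs_of_nonneg hb] at hp
    rw [abs_of_nonpos hb'] at hp'
    gcongr <;> linarith
  · right
    rw [abs_of_nonpos hb] at hp
    rw [abs_of_nonneg hb'] at hp'
    rw [add_comm (Real.exp (a' + b'))]
    gcongr <;> linarith
  · rw [abs_of_nonpos hb] at hp
    rw [abs_of_nonpos hb'] at hp'
    rcases le_total b' b with hbb | hbb
    · left
      rw [abs_of_nonneg (sub_nonneg.2 hbb)] at hpp
      have := exp_sub_exp_le (a := a + p) (b := a + b) (a' := a' - b') (b' := a' - p')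
        (by linarith) (by linarith) (by linarith)
      linarith
    · right
      rw [abs_of_nonpos (sub_nonpos.2 hbb)] at hpp
      have := exp_sub_exp_le (a := a' - p') (b := a' + b') (a' := a - b) (b' := a + p)
        (by linarith) (by linarith) (by linarith)
      linarith

theorem exists_selector_exp_contraction {Θ : Type*} (p b : Θ → ℝ)
    (hpp : ∀ θ θ', |p θ - p θ'| ≤ |b θ - b θ'|) (hp : ∀ θ, |p θ| ≤ |b θ|)
    (A : Θ → ℝ) (t : Bool → Θ) :
    ∃ t' : Bool → Θ, ∑ e, Real.exp (A (t e) + signVal e * p (t e)) ≤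
      ∑ e, Real.exp (A (t' e) + signVal e * b (t' e)) := by
  simp only [Fintype.sum_bool, signVal_true, signVal_false, one_mul, neg_one_mul,
    ← sub_eq_add_neg]
  have key : ∀ θ θ', A θ' + p θ' ≤ A θ + p θ → A θ - p θ ≤ A θ' - p θ' → ∃ t' : Bool → Θ,
      Real.exp (A θ + p θ) + Real.exp (A θ' - p θ') ≤
        Real.exp (A (t' true) + b (t' true)) + Real.exp (A (t' false) - b (t' false)) := by
    intro θ θ' h1 h2
    rcases exp_add_exp_contraction (hpp θ θ') (hp θ) (hp θ') h1 h2 with h | h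
    · exact ⟨fun e => if e then θ else θ', by simpa using h⟩
    · exact ⟨fun e => if e then θ' else θ, by simpa using h⟩
  -- If one parameter is the better one for both signs, it may be used for both; otherwise the two
  -- are already in the order that `key` needs, or are improved by this replacement.
  rcases le_total (A (t false) + p (t false)) (A (t true) + p (t true)) with h1 | h1
  · rcases le_total (A (t true) - p (t true)) (A (t false) - p (t false)) with h2 | h2
    · exact key _ _ h1 h2
    · obtain ⟨t', ht'⟩ := key (t true) (t true) le_rfl le_rfl
      exact ⟨t', le_trans (by gcongr) ht'⟩
  · obtain ⟨t', ht'⟩ := key (t false) (t false) le_rfl le_rfl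
    exact ⟨t', le_trans (by gcongr) ht'⟩

/-! ### Exponential moments of signed sums of vectors -/

/-- The power series of `cosh √q` in `q` has nonnegative coefficients. -/
lemma convexOn_cosh_sqrt : ConvexOn ℝ (Set.Ici 0) fun q : ℝ => Real.cosh √q := by
  have hs : ∀ q : ℝ, 0 ≤ q →
      HasSum (fun n : ℕ => q ^ n / ((2 * n).factorial : ℝ)) (Real.cosh √q) := by
    intro q hq
    have := Real.hasSum_cosh √q
    simpa only [pow_mul, Real.sq_sqrt hq] using this
  refine ⟨convex_Ici 0, fun x hx y hy a b ha hb hab => ?_⟩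
  rw [Set.mem_Ici] at hx hy
  have h0 : 0 ≤ a • x + b • y := by simp only [smul_eq_mul]; positivity
  refine hasSum_le (fun n => ?_) (hs _ h0) (((hs x hx).mul_left a).add ((hs y hy).mul_left b))
  have := (convexOn_pow n).2 hx hy ha hb hab
  rw [← mul_div_assoc, ← mul_div_assoc, ← add_div]
  gcongr
  simpa using this

/-- By the parallelogram law `‖v ± x‖²` have the same sum as `(‖v‖ ± ‖x‖)²` and lie between them.
Convexity of `cosh ∘ √` favours the extreme pair, to which the addition formulas apply. -/
lemma cosh_norm_add_add_cosh_norm_sub_le {E : Type*} [NormedAddCommGroup E]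
    [InnerProductSpace ℝ E] (v x : E) :
    Real.cosh ‖v + x‖ + Real.cosh ‖v - x‖ ≤ 2 * (Real.cosh ‖v‖ * Real.cosh ‖x‖) := by
  have hsum := parallelogram_law_with_norm ℝ v x
  have hle : (‖v‖ - ‖x‖) ^ 2 ≤ (‖v‖ + ‖x‖) ^ 2 := by
    nlinarith [mul_nonneg (norm_nonneg v) (norm_nonneg x)]
  have hmem : ‖v + x‖ ^ 2 ∈ segment ℝ ((‖v‖ - ‖x‖) ^ 2) ((‖v‖ + ‖x‖) ^ 2) := by
    rw [segment_eq_Icc hle]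
    refine ⟨?_, by gcongr; exact norm_add_le v x⟩
    rw [sq_le_sq, abs_of_nonneg (norm_nonneg (v + x))]
    simpa using abs_norm_sub_norm_le v (-x)
  obtain ⟨a, b, ha, hb, hab, h1⟩ := hmem
  have h2 : b • (‖v‖ - ‖x‖) ^ 2 + a • (‖v‖ + ‖x‖) ^ 2 = ‖v - x‖ ^ 2 := by
    have hb' : b = 1 - a := by linarith
    subst hb'
    simp only [smul_eq_mul] at h1 ⊢
    nlinarith
  have c1 := convexOn_cosh_sqrt.2 (Set.mem_Ici.2 (sq_nonneg (‖v‖ - ‖x‖)))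
    (Set.mem_Ici.2 (sq_nonneg (‖v‖ + ‖x‖))) ha hb hab
  have c2 := convexOn_cosh_sqrt.2 (Set.mem_Ici.2 (sq_nonneg (‖v‖ - ‖x‖)))
    (Set.mem_Ici.2 (sq_nonneg (‖v‖ + ‖x‖))) hb ha (by linarith)
  rw [h1] at c1
  rw [h2] at c2
  simp only [Real.sqrt_sq_eq_abs, abs_norm, Real.cosh_abs, smul_eq_mul] at c1 c2
  rw [Real.cosh_add, Real.cosh_sub] at c1 c2
  have hb' : b = 1 - a := by linarith
  subst hb'
  linarith

theorem sum_cosh_norm_le {E : Type*} [NormedAddCommGroup E] [InnerProductSpace ℝ E] {n : ℕ}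
    (x : Fin n → E) (v : E) :
    ∑ ε : Fin n → Bool, Real.cosh ‖v + ∑ i, signVal (ε i) • x i‖ ≤
      2 ^ n * (Real.cosh ‖v‖ * Real.exp ((∑ i, ‖x i‖ ^ 2) / 2)) := by
  induction n generalizing v with
  | zero => simp
  | succ n ih =>
    rw [← (Fin.consEquiv (fun _ => Bool)).sum_comp, Fintype.sum_prod_type]
    simp only [Fin.consEquiv_apply, Fin.sum_univ_succ, Fin.cons_zero, Fin.cons_succ,
      Fintype.sum_bool, signVal_true, signVal_false, ← add_assoc, one_smul, neg_one_smul,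
      ← sub_eq_add_neg]
    have h1 := ih (fun i => x i.succ) (v + x 0)
    have h2 := ih (fun i => x i.succ) (v - x 0)
    have h3 := cosh_norm_add_add_cosh_norm_sub_le v (x 0)
    have h4 := Real.cosh_le_exp_half_sq ‖x 0‖
    have h5 := Real.cosh_pos ‖v‖
    calc _ ≤ 2 ^ n * ((Real.cosh ‖v + x 0‖ + Real.cosh ‖v - x 0‖) *
            Real.exp ((∑ i : Fin n, ‖x i.succ‖ ^ 2) / 2)) := by linarith
      _ ≤ 2 ^ n * ((2 * (Real.cosh ‖v‖ * Real.exp (‖x 0‖ ^ 2 / 2))) *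
            Real.exp ((∑ i : Fin n, ‖x i.succ‖ ^ 2) / 2)) := by
          gcongr
          exact h3.trans (by gcongr)
      _ = _ := by
          rw [add_div, Real.exp_add]; ring

/-- Jensen's inequality for `cosh ∘ √` bounds the cosh of the root mean square; the 2 in the
logarithm comes from `exp y ≤ 2 cosh y`. -/
lemma sqrt_mean_sq_le_of_sum_cosh_le {ι : Type*} [Fintype ι] [Nonempty ι] (z : ι → ℝ) {K κ : ℝ}
    (hκ : 0 ≤ κ) (h : ∑ i, Real.cosh (κ * z i) ≤ Fintype.card ι * K) :
    κ * √((∑ i, z i ^ 2) / Fintype.card ι) ≤ Real.log (2 * K) := by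
  have hN : (0 : ℝ) < Fintype.card ι := by exact_mod_cast Fintype.card_pos
  have hJ := convexOn_cosh_sqrt.map_sum_le (t := Finset.univ)
    (w := fun _ : ι => (Fintype.card ι : ℝ)⁻¹) (p := fun i => (κ * z i) ^ 2)
    (fun _ _ => by positivity) (by simp [hN.ne']) (fun i _ => sq_nonneg (κ * z i))
  simp only [Real.sqrt_sq_eq_abs, Real.cosh_abs, smul_eq_mul, ← Finset.mul_sum] at hJ
  simp only [mul_pow, ← Finset.mul_sum] at hJ
  have e1 : √((Fintype.card ι : ℝ)⁻¹ * (κ ^ 2 * ∑ i, z i ^ 2)) =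
      κ * √((∑ i, z i ^ 2) / Fintype.card ι) := by
    rw [show (Fintype.card ι : ℝ)⁻¹ * (κ ^ 2 * ∑ i, z i ^ 2) =
      κ ^ 2 * ((∑ i, z i ^ 2) / Fintype.card ι) by ring, Real.sqrt_mul (sq_nonneg κ),
      Real.sqrt_sq hκ]
  rw [e1] at hJ
  set y := κ * √((∑ i, z i ^ 2) / Fintype.card ι)
  have h1 : Real.cosh y ≤ K := by
    refine hJ.trans ?_
    rw [inv_mul_le_iff₀ hN]
    exact h
  have h2 : Real.exp y ≤ 2 * K := by
    rw [Real.cosh_eq] at h1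
    linarith [Real.exp_pos (-y)]
  rw [Real.le_log_iff_exp_le (lt_of_lt_of_le (Real.exp_pos y) h2)]
  exact h2


/-! ### Peeling off the layers of the network -/

lemma frobenius_norm_sq {a b : Type*} [Fintype a] [Fintype b] (W : Matrix a b ℝ) :
    ‖W‖ ^ 2 = ∑ i, ∑ j, W i j ^ 2 := by
  rw [Matrix.frobenius_norm_def, ← Real.sqrt_eq_rpow, Real.sq_sqrt (by positivity)]
  simp

lemma map_zero_of_pos_homogeneous {s : ℝ → ℝ} (hs : ∀ a : ℝ, 0 < a → ∀ u, s (a * u) = a * s u) :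
    s 0 = 0 := by
  have := hs 2 two_pos 0
  rw [mul_zero] at this
  linarith

/-- The norm of a signed sum of activated layers is attained, up to the Frobenius norm of the
layer, by a single normalized row. -/
theorem exists_unit_norm_sum_activation_le {a b n : ℕ} {s : ℝ → ℝ}
    (hs : ∀ a : ℝ, 0 < a → ∀ u, s (a * u) = a * s u) (W : Matrix (Fin a) (Fin b) ℝ) {M : ℝ}
    (hW : ‖W‖ ≤ M) (φ : Fin n → Fin b → ℝ) (c : Fin n → ℝ) :
    ∃ w : EuclideanSpace ℝ (Fin b), ‖w‖ ≤ 1 ∧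
      ‖∑ j, c j • (WithLp.toLp 2 fun r => s ((W *ᵥ φ j) r) : EuclideanSpace ℝ (Fin a))‖ ≤
        M * |∑ j, c j * s (w ⬝ᵥ φ j)| := by
  have hM : 0 ≤ M := (norm_nonneg W).trans hW
  rcases isEmpty_or_nonempty (Fin a) with ha | ha
  · refine ⟨0, by simp, ?_⟩
    rw [Subsingleton.elim (∑ j, _) (0 : EuclideanSpace ℝ (Fin a)), norm_zero]
    positivity
  let row : Fin a → EuclideanSpace ℝ (Fin b) := fun r => WithLp.toLp 2 (W r)
  -- A zero row stays zero here, since `0⁻¹ = 0`; it contributes nothing because `s 0 = 0`.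
  let unit : Fin a → EuclideanSpace ℝ (Fin b) := fun r => ‖row r‖⁻¹ • row r
  have hunit : ∀ r, ‖unit r‖ ≤ 1 := by
    intro r
    rw [norm_smul, norm_inv, norm_norm]
    exact inv_mul_le_one
  obtain ⟨r, -, hr⟩ := Finset.exists_max_image Finset.univ
    (fun r => |∑ j, c j * s (unit r ⬝ᵥ φ j)|) Finset.univ_nonempty
  refine ⟨unit r, hunit r, ?_⟩
  have hentry : ∀ r', ∑ j, c j * s ((W *ᵥ φ j) r') =
      ‖row r'‖ * ∑ j, c j * s (unit r' ⬝ᵥ φ j) := by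
    intro r'
    rw [Finset.mul_sum]
    refine Finset.sum_congr rfl fun j _ => ?_
    have e : (W *ᵥ φ j) r' = (row r').ofLp ⬝ᵥ φ j := rfl
    rcases eq_or_ne (row r') 0 with h0 | h0
    · rw [e, h0]; simp [map_zero_of_pos_homogeneous hs]
    · rw [mul_left_comm, ← hs _ (norm_pos_iff.2 h0), e]
      simp [unit, smul_dotProduct, norm_ne_zero_iff.2 h0]
  have hsq : ∑ r', ‖row r'‖ ^ 2 = ‖W‖ ^ 2 := by
    rw [frobenius_norm_sq]
    simp [row, EuclideanSpace.norm_sq_eq]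
  -- By homogeneity the squared norm is a combination of squared correlations of normalized rows,
  -- with the squared row norms as weights; these sum to `‖W‖²`, so the best row bounds it.
  refine abs_le_of_sq_le_sq' ?_ (by positivity) |>.2
  rw [EuclideanSpace.norm_sq_eq]
  calc ∑ r', ‖(∑ j, c j • (WithLp.toLp 2 fun r => s ((W *ᵥ φ j) r) :
          EuclideanSpace ℝ (Fin a))) r'‖ ^ 2
      = ∑ r', ‖row r'‖ ^ 2 * |∑ j, c j * s (unit r' ⬝ᵥ φ j)| ^ 2 := by
        refine Finset.sum_congr rfl fun r' _ => ?_
        rw [sq_abs, ← mul_pow, ← hentry]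
        simp
    _ ≤ ∑ r', ‖row r'‖ ^ 2 * |∑ j, c j * s (unit r ⬝ᵥ φ j)| ^ 2 := by
        refine Finset.sum_le_sum fun r' _ => mul_le_mul_of_nonneg_left ?_ (by positivity)
        exact pow_le_pow_left₀ (abs_nonneg _) (hr r' (Finset.mem_univ r')) 2
    _ ≤ _ := by
        rw [← Finset.sum_mul, hsq, mul_pow]
        gcongr

variable {C L : ℕ} {h : ℕ → ℕ}

/-- The hidden feature as a point of Euclidean space. -/
def Weights.euclideanFeature (W : Weights C L h) (σ : Fin L → ℝ → ℝ)
    (x : EuclideanSpace ℝ (Fin (h 0))) (i : ℕ) (hi : i ≤ L) : EuclideanSpace ℝ (Fin (h i)) :=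
  WithLp.toLp 2 (W.feature σ x i hi)

lemma Weights.feature_zero (W : Weights C L h) {σ : Fin L → ℝ → ℝ}
    (hσ : ∀ i, σ i 0 = 0) (i : ℕ) (hi : i ≤ L) : W.feature σ 0 i hi = 0 := by
  induction i with
  | zero => ext r; simp [Weights.feature]
  | succ i ih =>
    ext r
    rw [Weights.feature, ih]
    simp [hσ]

theorem sum_exp_activation_le {Θ : Type*} {n : ℕ} {s : ℝ → ℝ} (hlip : LipschitzWith 1 s)
    (h0 : s 0 = 0) (κ : ℝ) (y : Fin n → Θ → ℝ) (t : (Fin n → Bool) → Θ) :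
    ∃ t' : (Fin n → Bool) → Θ,
      ∑ ε, Real.exp (κ * ∑ j, signVal (ε j) * s (y j (t ε))) ≤
        ∑ ε, Real.exp (κ * ∑ j, signVal (ε j) * y j (t' ε)) := by
  have hl : ∀ u v, |s u - s v| ≤ |u - v| := by
    intro u v; simpa [Real.dist_eq] using hlip.dist_le_mul u v
  obtain ⟨t', ht'⟩ := exists_selector_sum_le Real.exp
    (fun j e θ => signVal e * (κ * s (y j θ))) (fun j e θ => signVal e * (κ * y j θ))
    (fun j A t => by
      obtain ⟨t', ht'⟩ := exists_selector_exp_contraction (fun θ => κ * s (y j θ))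
        (fun θ => κ * y j θ)
        (fun θ θ' => by
          rw [← mul_sub, ← mul_sub, abs_mul, abs_mul]
          exact mul_le_mul_of_nonneg_left (hl _ _) (abs_nonneg κ))
        (fun θ => by
          rw [abs_mul, abs_mul]
          exact mul_le_mul_of_nonneg_left (by simpa [h0] using hl (y j θ) 0) (abs_nonneg κ)) A t
      exact ⟨t', mul_le_mul_of_nonneg_left ht' (by positivity)⟩) (fun _ => 0) t
  refine ⟨t', ?_⟩
  have := le_of_mul_le_mul_left ht' (by simp)
  simpa only [zero_add, Finset.mul_sum, mul_left_comm κ] using this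

/-- The layers of a network are peeled off one by one; each hidden layer costs a factor `2`. -/
theorem sum_cosh_norm_feature_le {σ : Fin L → ℝ → ℝ} (hσ_lip : ∀ i, LipschitzWith 1 (σ i))
    (hσ_hom : ∀ i, ∀ a : ℝ, 0 < a → ∀ u : ℝ, σ i (a * u) = a * σ i u)
    (Mw : ℕ → ℝ) {n : ℕ} (x : Fin n → EuclideanSpace ℝ (Fin (h 0))) (i : ℕ) (hi : i ≤ L)
    {κ : ℝ} (hκ : 0 ≤ κ) (W : (Fin n → Bool) → Weights C L h)
    (hW : ∀ ε k, ‖(W ε).hidden k‖ ≤ Mw k) :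
    ∑ ε : Fin n → Bool, Real.cosh (κ * ‖∑ j, signVal (ε j) •
        (W ε).euclideanFeature σ (x j) i hi‖) ≤
      2 ^ n * (2 ^ i * Real.exp ((κ * ∏ k ∈ Finset.range i, Mw k) ^ 2 *
        (∑ j, ‖x j‖ ^ 2) / 2)) := by
  induction i generalizing κ W with
  | zero =>
    have := sum_cosh_norm_le (fun j => κ • x j) 0
    simp only [norm_zero, Real.cosh_zero, zero_add, one_mul, norm_smul, mul_pow,
      ← Finset.mul_sum, smul_comm _ κ, ← Finset.smul_sum, Real.norm_eq_abs,
      abs_of_nonneg hκ] at this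
    have e : ∀ (W : Weights C L h) x, W.euclideanFeature σ x 0 hi = x := fun _ _ => rfl
    simpa [e] using this
  | succ i ih =>
    have hi' : i < L := hi
    let w : (ε : Fin n → Bool) → EuclideanSpace ℝ (Fin (h i)) := fun ε =>
      (exists_unit_norm_sum_activation_le (hσ_hom ⟨i, hi'⟩) ((W ε).hidden ⟨i, hi'⟩)
        (hW ε ⟨i, hi'⟩) (fun j => (W ε).feature σ (x j) i hi'.le) (fun j => signVal (ε j))).choose
    have hw : ∀ ε, ‖w ε‖ ≤ 1 ∧ ‖∑ j, signVal (ε j) • (W ε).euclideanFeature σ (x j) (i + 1) hi‖ ≤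
        Mw i * |∑ j, signVal (ε j) * σ ⟨i, hi'⟩ (w ε ⬝ᵥ (W ε).feature σ (x j) i hi'.le)| :=
      fun ε => (exists_unit_norm_sum_activation_le (hσ_hom ⟨i, hi'⟩) ((W ε).hidden ⟨i, hi'⟩)
        (hW ε ⟨i, hi'⟩) (fun j => (W ε).feature σ (x j) i hi'.le)
        (fun j => signVal (ε j))).choose_spec
    have hM : 0 ≤ Mw i := (norm_nonneg _).trans (hW (fun _ => true) ⟨i, hi'⟩)
    -- The contraction may move the network and the row together, so the parameter is the pair.
    let Θ := {W : Weights C L h // ∀ k, ‖W.hidden k‖ ≤ Mw k} ×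
      {w : EuclideanSpace ℝ (Fin (h i)) // ‖w‖ ≤ 1}
    let y : Fin n → Θ → ℝ := fun j θ => θ.2.1 ⬝ᵥ θ.1.1.feature σ (x j) i hi'.le
    set K := (2 : ℝ) ^ n * (2 ^ i * Real.exp ((κ * Mw i * ∏ k ∈ Finset.range i, Mw k) ^ 2 *
        (∑ j, ‖x j‖ ^ 2) / 2)) with hK
    have hκM : 0 ≤ κ * Mw i := mul_nonneg hκ hM
    have hinner : ∀ (ε : Fin n → Bool) (θ : Θ), ∑ j, signVal (ε j) * y j θ ≤
        ‖∑ j, signVal (ε j) • θ.1.1.euclideanFeature σ (x j) i hi'.le‖ := by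
      intro ε θ
      have e : ∑ j, signVal (ε j) * y j θ =
          inner ℝ (∑ j, signVal (ε j) • θ.1.1.euclideanFeature σ (x j) i hi'.le) θ.2.1 := by
        rw [sum_inner]
        refine Finset.sum_congr rfl fun j _ => ?_
        rw [real_inner_smul_left, EuclideanSpace.inner_eq_star_dotProduct]
        simp [y, Weights.euclideanFeature]
      rw [e]
      refine (real_inner_le_norm _ _).trans (mul_le_of_le_one_right (norm_nonneg _) θ.2.2)
    have key : ∀ t : (Fin n → Bool) → Θ,
        ∑ ε, Real.exp (κ * Mw i * ∑ j, signVal (ε j) * σ ⟨i, hi'⟩ (y j (t ε))) ≤ 2 * K := by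
      intro t
      obtain ⟨t', ht'⟩ := sum_exp_activation_le (hσ_lip ⟨i, hi'⟩)
        (map_zero_of_pos_homogeneous (hσ_hom ⟨i, hi'⟩)) (κ * Mw i) y t
      refine ht'.trans ?_
      refine le_trans ?_ (mul_le_mul_of_nonneg_left
        (ih hi'.le hκM (fun ε => (t' ε).1.1) (fun ε => (t' ε).1.2)) two_pos.le)
      rw [Finset.mul_sum]
      refine Finset.sum_le_sum fun ε _ => ?_
      -- Returning from `exp` to `cosh` through `exp y ≤ 2 cosh y` is where the layer costs its
      -- factor 2.
      have h1 := Real.exp_le_exp.2 (mul_le_mul_of_nonneg_left (hinner ε (t' ε)) hκM)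
      refine h1.trans ?_
      rw [Real.cosh_eq]
      have := Real.exp_pos (-(κ * Mw i *
        ‖∑ j, signVal (ε j) • (t' ε).1.1.euclideanFeature σ (x j) i hi'.le‖))
      linarith
    let t : (Fin n → Bool) → Θ := fun ε => (⟨W ε, hW ε⟩, ⟨w ε, (hw ε).1⟩)
    have k1 := key t
    -- The other half of the cosh, with exponent of opposite sign, is the same estimate for the
    -- selector precomposed with the flip of all signs.
    have k2 := key (fun ε => t fun j => !ε j)
    have k3 := sum_comp_not (fun ε : Fin n → Bool =>
      Real.exp (-(κ * Mw i * ∑ j, signVal (ε j) * σ ⟨i, hi'⟩ (y j (t ε)))))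
    simp only [signVal_not, neg_mul, Finset.sum_neg_distrib, mul_neg, neg_neg] at k3
    rw [k3] at k2
    calc _ ≤ ∑ ε, Real.cosh (κ * Mw i * ∑ j, signVal (ε j) * σ ⟨i, hi'⟩ (y j (t ε))) := by
          refine Finset.sum_le_sum fun ε _ => ?_
          rw [Real.cosh_le_cosh, abs_of_nonneg (by positivity), abs_mul, abs_of_nonneg hκM,
            mul_assoc]
          exact mul_le_mul_of_nonneg_left (hw ε).2 hκ
      _ ≤ 2 * K := by
          simp only [Real.cosh_eq]
          rw [← Finset.sum_div, Finset.sum_add_distrib]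
          linarith
      _ = _ := by
          rw [hK, Finset.prod_range_succ, mul_comm _ (Mw i), ← mul_assoc κ]
          ring_nf

/-- The choice `κ = √(2 D) / q` is optimal; for `q = 0` a large `κ` rules out `y > 0`. -/
lemma le_sqrt_mul_of_forall_mul_le {y D q : ℝ} (hD : 0 < D) (hq : 0 ≤ q)
    (hy : ∀ κ, 0 ≤ κ → κ * y ≤ D + κ ^ 2 * q ^ 2 / 2) : y ≤ √(2 * D) * q := by
  have h2 : √(2 * D) ^ 2 = 2 * D := Real.sq_sqrt (by positivity)
  have h3 : 0 < √(2 * D) := Real.sqrt_pos.2 (by positivity)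
  rcases hq.eq_or_lt with rfl | hq
  · by_contra! hlt
    rw [mul_zero] at hlt
    have := hy ((D + 1) / y) (by positivity)
    rw [div_mul_cancel₀ _ hlt.ne'] at this
    linarith
  · have := hy (√(2 * D) / q) (by positivity)
    rw [div_pow, div_mul_cancel₀ _ (by positivity), h2, div_mul_eq_mul_div, div_le_iff₀ hq] at this
    nlinarith

/-- The `L` factors 2 from the hidden layers and the one from Jensen's step give `(L + 1) log 2`. -/
theorem mean_sq_norm_feature_le {σ : Fin L → ℝ → ℝ} (hσ_lip : ∀ i, LipschitzWith 1 (σ i))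
    (hσ_hom : ∀ i, ∀ a : ℝ, 0 < a → ∀ u : ℝ, σ i (a * u) = a * σ i u)
    (Mw : ℕ → ℝ) {n : ℕ} (x : Fin n → EuclideanSpace ℝ (Fin (h 0)))
    (W : (Fin n → Bool) → Weights C L h) (hW : ∀ ε k, ‖(W ε).hidden k‖ ≤ Mw k) :
    ∑ ε : Fin n → Bool, ‖∑ j, signVal (ε j) • (W ε).euclideanFeature σ (x j) L le_rfl‖ ^ 2 ≤
      2 ^ n * (2 * ((L + 1) * Real.log 2) * (∏ k ∈ Finset.range L, Mw k) ^ 2 *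
        ∑ j, ‖x j‖ ^ 2) := by
  set Q := ∏ k ∈ Finset.range L, Mw k
  have hQ : 0 ≤ Q := Finset.prod_nonneg fun k hk =>
    (norm_nonneg _).trans (hW (fun _ => true) ⟨k, Finset.mem_range.1 hk⟩)
  set S := ∑ j, ‖x j‖ ^ 2
  have hS : 0 ≤ S := by positivity
  set z : (Fin n → Bool) → ℝ := fun ε =>
    ‖∑ j, signVal (ε j) • (W ε).euclideanFeature σ (x j) L le_rfl‖
  have hcard : (Fintype.card (Fin n → Bool) : ℝ) = 2 ^ n := by simp
  have hD : 0 < ((L : ℝ) + 1) * Real.log 2 := by positivity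
  have h1 : √((∑ ε, z ε ^ 2) / Fintype.card (Fin n → Bool)) ≤
      √(2 * (((L : ℝ) + 1) * Real.log 2)) * (Q * √S) := by
    refine le_sqrt_mul_of_forall_mul_le hD (by positivity) fun κ hκ => ?_
    have h2 := sqrt_mean_sq_le_of_sum_cosh_le z hκ (by
      rw [hcard]
      exact sum_cosh_norm_feature_le hσ_lip hσ_hom Mw x L le_rfl hκ W hW)
    refine h2.trans (le_of_eq ?_)
    rw [← mul_assoc, ← pow_succ', Real.log_mul (by positivity) (Real.exp_pos _).ne', Real.log_exp,
      Real.log_pow, mul_pow, mul_pow, Real.sq_sqrt hS]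
    push_cast
    ring
  have h2 := Real.sqrt_le_left (by positivity) |>.1 h1
  rw [hcard, div_le_iff₀ (by positivity), mul_pow, mul_pow, Real.sq_sqrt (by positivity),
    Real.sq_sqrt hS] at h2
  linarith


theorem mean_sq_norm_feature_le_of_fintype {σ : Fin L → ℝ → ℝ}
    (hσ_lip : ∀ i, LipschitzWith 1 (σ i))
    (hσ_hom : ∀ i, ∀ a : ℝ, 0 < a → ∀ u : ℝ, σ i (a * u) = a * σ i u)
    (Mw : ℕ → ℝ) {J : Type*} [Fintype J] [DecidableEq J] (x : J → EuclideanSpace ℝ (Fin (h 0)))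
    (W : (J → Bool) → Weights C L h) (hW : ∀ ε k, ‖(W ε).hidden k‖ ≤ Mw k) :
    ∑ ε : J → Bool, ‖∑ j, signVal (ε j) • (W ε).euclideanFeature σ (x j) L le_rfl‖ ^ 2 ≤
      2 ^ Fintype.card J * (2 * ((L + 1) * Real.log 2) * (∏ k ∈ Finset.range L, Mw k) ^ 2 *
        ∑ j, ‖x j‖ ^ 2) := by
  let e := Fintype.equivFin J
  let E : (Fin (Fintype.card J) → Bool) ≃ (J → Bool) := e.symm.arrowCongr (Equiv.refl Bool)
  have := mean_sq_norm_feature_le hσ_lip hσ_hom Mw (fun j => x (e.symm j)) (fun ε => W (E ε))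
    (fun ε => hW (E ε))
  rw [← E.sum_comp]
  rw [e.symm.sum_comp (fun j => ‖x j‖ ^ 2)] at this
  refine le_trans (le_of_eq ?_) this
  refine Finset.sum_congr rfl fun ε _ => ?_
  rw [← e.symm.sum_comp]
  simp [E, Equiv.arrowCongr]

/-- The correlation of random signs with the outputs of the network, one sign for each entry of
the row that belongs to the data point. -/
theorem sum_sign_net_le {σ : Fin L → ℝ → ℝ} (hσ_lip : ∀ i, LipschitzWith 1 (σ i))
    (hσ_hom : ∀ i, ∀ a : ℝ, 0 < a → ∀ u : ℝ, σ i (a * u) = a * σ i u)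
    (Mw : ℕ → ℝ) {B : ℝ} (hB : 0 ≤ B) {m : ℕ} (x : Fin m → EuclideanSpace ℝ (Fin (h 0)))
    (hx : ∀ i, ‖x i‖ ≤ B) (a : Fin m → Fin C) (W : (Fin m × Fin C → Bool) → Weights C L h)
    (hW : ∀ ε k, ‖(W ε).hidden k‖ ≤ Mw k) (hWo : ∀ ε, ‖(W ε).output‖ ≤ Mw L) :
    ∑ ε : Fin m × Fin C → Bool, ∑ i, ∑ b, signVal (ε (i, b)) * (W ε).net σ (x i) (a i) b ≤
      2 ^ (m * C) * (√(2 * ((L + 1) * Real.log 2)) * B * (∏ k ∈ Finset.range (L + 1), Mw k) *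
        √(C * m)) := by
  set Q := ∏ k ∈ Finset.range L, Mw k with hQdef
  have hQ : 0 ≤ Q := Finset.prod_nonneg fun k hk =>
    (norm_nonneg _).trans (hW (fun _ => true) ⟨k, Finset.mem_range.1 hk⟩)
  have hML : 0 ≤ Mw L := (norm_nonneg _).trans (hWo (fun _ => true))
  -- Each output entry gets its own sample, indexed by all `m C` signs, with input 0 where the sign
  -- concerns another entry. Zero inputs have zero features, so one second-moment bound serves all
  -- entries with a common selector.
  let xt : Fin C × Fin C → Fin m × Fin C → EuclideanSpace ℝ (Fin (h 0)) := fun ab j =>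
    if (a j.1, j.2) = ab then x j.1 else 0
  let V : (Fin m × Fin C → Bool) → Fin C × Fin C → EuclideanSpace ℝ (Fin (h L)) := fun ε ab =>
    ∑ j, signVal (ε j) • (W ε).euclideanFeature σ (xt ab j) L le_rfl
  let G : (Fin m × Fin C → Bool) → ℝ := fun ε => ∑ ab, ‖V ε ab‖ ^ 2
  have hG : ∀ ε, 0 ≤ G ε := fun ε => by positivity
  have hzero : ∀ W : Weights C L h, W.euclideanFeature σ 0 L le_rfl = 0 := fun W => by
    rw [Weights.euclideanFeature,
      W.feature_zero (fun i => map_zero_of_pos_homogeneous (hσ_hom i))]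
    rfl
  have hrow : ∀ ε, ∑ i, ∑ b, signVal (ε (i, b)) * (W ε).net σ (x i) (a i) b =
      ∑ ab, ∑ r, (W ε).output ab r * V ε ab r := by
    intro ε
    rw [← Fintype.sum_prod_type']
    have e1 : ∀ ab r, V ε ab r = ∑ j : Fin m × Fin C,
        if (a j.1, j.2) = ab then signVal (ε j) * (W ε).feature σ (x j.1) L le_rfl r else 0 := by
      intro ab r
      simp only [V, WithLp.ofLp_sum, Finset.sum_apply, WithLp.ofLp_smul, Pi.smul_apply,
        smul_eq_mul]
      refine Finset.sum_congr rfl fun j _ => ?_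
      by_cases hj : (a j.1, j.2) = ab
      · simp [xt, hj, Weights.euclideanFeature]
      · simp [xt, hj, hzero]
    simp only [e1, Finset.mul_sum, mul_ite, mul_zero]
    have e2 : ∀ ab : Fin C × Fin C, ∑ r, ∑ j : Fin m × Fin C, (if (a j.1, j.2) = ab then
        (W ε).output ab r * (signVal (ε j) * (W ε).feature σ (x j.1) L le_rfl r) else 0) =
        ∑ j : Fin m × Fin C, if (a j.1, j.2) = ab then ∑ r,
          (W ε).output ab r * (signVal (ε j) * (W ε).feature σ (x j.1) L le_rfl r) else 0 := by
      intro ab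
      rw [Finset.sum_comm]
      refine Finset.sum_congr rfl fun j _ => ?_
      split_ifs <;> simp
    simp only [e2]
    rw [Finset.sum_comm]
    refine Finset.sum_congr rfl fun j _ => ?_
    rw [Finset.sum_ite_eq, if_pos (Finset.mem_univ _)]
    simp only [Weights.net, Matrix.of_apply, Matrix.mulVec, dotProduct, Finset.mul_sum]
    exact Finset.sum_congr rfl fun r _ => by ring
  have hCS : ∀ ε, ∑ i, ∑ b, signVal (ε (i, b)) * (W ε).net σ (x i) (a i) b ≤
      Mw L * √(G ε) := by
    intro ε
    rw [hrow, ← Fintype.sum_prod_type']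
    refine (Real.sum_mul_le_sqrt_mul_sqrt _ _ _).trans ?_
    have e1 : ∑ p : (Fin C × Fin C) × Fin (h L), (W ε).output p.1 p.2 ^ 2 =
        ‖(W ε).output‖ ^ 2 := by
      rw [frobenius_norm_sq, Fintype.sum_prod_type]
    have e2 : ∑ p : (Fin C × Fin C) × Fin (h L), V ε p.1 p.2 ^ 2 = G ε := by
      rw [Fintype.sum_prod_type]
      simp [G, EuclideanSpace.norm_sq_eq]
    rw [e1, e2, Real.sqrt_sq (norm_nonneg _)]
    exact mul_le_mul_of_nonneg_right (hWo ε) (Real.sqrt_nonneg _)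
  have hxt : ∑ ab, ∑ j, ‖xt ab j‖ ^ 2 ≤ C * m * B ^ 2 := by
    rw [Finset.sum_comm]
    have : ∀ j : Fin m × Fin C, ∑ ab, ‖xt ab j‖ ^ 2 = ‖x j.1‖ ^ 2 := by
      intro j
      rw [Finset.sum_eq_single (a j.1, j.2)]
      · simp [xt]
      · intro b _ hb
        simp [xt, hb.symm]
      · simp
    simp only [this]
    calc ∑ j : Fin m × Fin C, ‖x j.1‖ ^ 2 ≤ ∑ _j : Fin m × Fin C, B ^ 2 := by
          refine Finset.sum_le_sum fun j _ => pow_le_pow_left₀ (norm_nonneg _) (hx j.1) 2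
      _ = C * m * B ^ 2 := by
          rw [Finset.sum_const, Finset.card_univ, Fintype.card_prod, Fintype.card_fin,
            Fintype.card_fin, nsmul_eq_mul, Nat.cast_mul, mul_comm (m : ℝ)]
  set D := 2 * (((L : ℝ) + 1) * Real.log 2) with hD
  have hD0 : 0 ≤ D := by positivity
  -- The sum over `C²` entries yields only `C m` squared input norms, because each index `(i, b)` is
  -- nonzero in at most one sample.
  have hGsum : ∑ ε, G ε ≤ 2 ^ (m * C) * (D * Q ^ 2 * (C * m * B ^ 2)) := by
    simp only [G]
    rw [Finset.sum_comm]
    calc _ ≤ ∑ ab : Fin C × Fin C, (2 : ℝ) ^ (m * C) * (D * Q ^ 2 * ∑ j, ‖xt ab j‖ ^ 2) := by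
          refine Finset.sum_le_sum fun ab _ => ?_
          have := mean_sq_norm_feature_le_of_fintype hσ_lip hσ_hom Mw (xt ab) W hW
          simpa using this
      _ ≤ _ := by
          rw [← Finset.mul_sum, ← Finset.mul_sum]
          gcongr
  have hsq : ∑ ε, √(G ε) ≤ 2 ^ (m * C) * (√D * Q * B * √(C * m)) := by
    refine abs_le_of_sq_le_sq' ?_ (by positivity) |>.2
    refine (sq_sum_le_card_mul_sum_sq).trans ?_
    simp only [Real.sq_sqrt (hG _)]
    calc _ ≤ (2 : ℝ) ^ (m * C) * (2 ^ (m * C) * (D * Q ^ 2 * (C * m * B ^ 2))) := by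
          refine mul_le_mul (by simp) hGsum (Finset.sum_nonneg fun ε _ => hG ε) (by positivity)
      _ = _ := by
          rw [mul_pow, mul_pow, mul_pow, mul_pow, Real.sq_sqrt hD0, Real.sq_sqrt (by positivity)]
          ring
  calc _ ≤ ∑ ε, Mw L * √(G ε) := Finset.sum_le_sum fun ε _ => hCS ε
    _ ≤ Mw L * (2 ^ (m * C) * (√D * Q * B * √(C * m))) := by
        rw [← Finset.mul_sum]
        exact mul_le_mul_of_nonneg_left hsq hML
    _ = _ := by
        rw [Finset.prod_range_succ, ← hQdef]; ring

/-! ### The loss as a function of the network -/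

lemma Weights.loss_eq (W : Weights C L h) (σ : Fin L → ℝ → ℝ) (z : DataPoint (h 0) C) :
    W.loss σ z = Real.log (∑ k, Real.exp (W.net σ z.1 z.2.2 k)) - W.net σ z.1 z.2.2 z.2.1 := by
  have : Nonempty (Fin C) := ⟨z.2.1⟩
  have hpos : 0 < ∑ k, Real.exp (W.net σ z.1 z.2.2 k) :=
    Finset.sum_pos (fun k _ => Real.exp_pos _) Finset.univ_nonempty
  simp only [Weights.loss, crossEntropy, oneHot, Matrix.single_one_vecMul, Pi.single_apply,
    ite_mul, one_mul, zero_mul, Finset.sum_ite_eq', Finset.mem_univ, if_true, Matrix.row,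
    Weights.transition, Matrix.of_apply]
  rw [Real.log_div (Real.exp_pos _).ne' hpos.ne', Real.log_exp]
  ring

lemma Weights.loss_nonneg (W : Weights C L h) (σ : Fin L → ℝ → ℝ) (z : DataPoint (h 0) C) :
    0 ≤ W.loss σ z := by
  rw [W.loss_eq, sub_nonneg, ← Real.log_exp (W.net σ z.1 z.2.2 z.2.1)]
  refine Real.log_le_log (Real.exp_pos _) ?_
  exact Finset.single_le_sum (f := fun k => Real.exp (W.net σ z.1 z.2.2 k))
    (fun k _ => (Real.exp_pos _).le) (Finset.mem_univ z.2.1)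

/-- Log-sum-exp is monotone, and adding `r` to all coordinates adds `r` to it. -/
lemma abs_log_sum_exp_sub_le {κ : Type*} [Fintype κ] [Nonempty κ] {u v : κ → ℝ} {r : ℝ}
    (huv : ∀ b, |u b - v b| ≤ r) :
    |Real.log (∑ k, Real.exp (u k)) - Real.log (∑ k, Real.exp (v k))| ≤ r := by
  have key : ∀ u v : κ → ℝ, (∀ b, u b - v b ≤ r) →
      Real.log (∑ k, Real.exp (u k)) - Real.log (∑ k, Real.exp (v k)) ≤ r := by
    intro u v huv
    have hu : 0 < ∑ k, Real.exp (u k) :=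
      Finset.sum_pos (fun k _ => Real.exp_pos _) Finset.univ_nonempty
    have hv : 0 < ∑ k, Real.exp (v k) :=
      Finset.sum_pos (fun k _ => Real.exp_pos _) Finset.univ_nonempty
    rw [sub_le_iff_le_add, ← Real.log_exp r, ← Real.log_mul (Real.exp_pos _).ne' hv.ne']
    refine Real.log_le_log hu ?_
    rw [Finset.mul_sum]
    refine Finset.sum_le_sum fun k _ => ?_
    rw [← Real.exp_add]
    exact Real.exp_le_exp.2 (by linarith [huv k])
  rw [abs_sub_le_iff]
  exact ⟨key u v fun b => (abs_sub_le_iff.1 (huv b)).1,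
    key v u fun b => (abs_sub_le_iff.1 (huv b)).2⟩

theorem sum_sign_loss_le {σ : Fin L → ℝ → ℝ} (hσ_lip : ∀ i, LipschitzWith 1 (σ i))
    (hσ_hom : ∀ i, ∀ a : ℝ, 0 < a → ∀ u : ℝ, σ i (a * u) = a * σ i u)
    (Mw : Fin (L + 1) → ℝ) {B : ℝ} (hB : 0 ≤ B) {m : ℕ} (S : Fin m → DataPoint (h 0) C)
    (hS : ∀ i, ‖(S i).1‖ ≤ B) [Nonempty (Fin C)] (W : (Fin m → Bool) → Weights C L h)
    (hW : ∀ ε, (W ε).FrobeniusBounded Mw) :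
    ∑ ε : Fin m → Bool, ∑ i, signVal (ε i) * (W ε).loss σ (S i) ≤
      2 ^ m * (2 * (√(2 * ((L + 1) * Real.log 2)) * B * (∏ k, Mw k) * √(C * m))) := by
  let Θ := {W : Weights C L h // W.FrobeniusBounded Mw}
  obtain ⟨t', ht'⟩ := exists_selector_sum_le (Θ := Θ) (α := Bool) (β := Fin C → Bool) id
    (fun i e θ => signVal e * θ.1.loss σ (S i))
    (fun i η θ => 2 * ∑ b, signVal (η b) * θ.1.net σ (S i).1 (S i).2.2 b)
    (fun i A t => by
      have := exists_selector_vector_contraction (fun θ : Θ => θ.1.loss σ (S i))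
        (fun θ b => θ.1.net σ (S i).1 (S i).2.2 b) (fun θ θ' r hr => by
          have h1 := abs_le.1 (abs_log_sum_exp_sub_le hr)
          have h2 := abs_le.1 (hr (S i).2.1)
          rw [Weights.loss_eq, Weights.loss_eq, abs_le]
          constructor <;> linarith) A t
      simpa using this) (fun _ => 0) (fun ε => ⟨W ε, hW ε⟩)
  -- The peeling lemmas index the bounds by `ℕ`; the value beyond `L` is never used.
  let Mn : ℕ → ℝ := fun k => if hk : k < L + 1 then Mw ⟨k, hk⟩ else 0
  have hMn : ∏ k ∈ Finset.range (L + 1), Mn k = ∏ k, Mw k := by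
    rw [Finset.prod_range]
    exact Finset.prod_congr rfl fun k _ => dif_pos k.2
  have key := sum_sign_net_le hσ_lip hσ_hom Mn hB (fun i => (S i).1) hS (fun i => (S i).2.2)
    (fun ε => (t' fun i b => ε (i, b)).1)
    (fun ε k => by
      rw [show Mn k = Mw k.castSucc from dif_pos k.castSucc.2]
      exact (t' fun i b => ε (i, b)).2.1 k)
    (fun ε => by
      rw [show Mn L = Mw (Fin.last L) from dif_pos (Fin.last L).2]
      exact (t' fun i b => ε (i, b)).2.2)
  rw [hMn, ← (Equiv.curry (Fin m) (Fin C) Bool).symm.sum_comp] at key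
  simp only [id, zero_add, ← Finset.mul_sum, Fintype.card_bool, Fintype.card_pi,
    Finset.prod_const, Finset.card_univ, Fintype.card_fin, Nat.cast_ofNat, Nat.cast_pow,
    ← pow_mul] at ht'
  rw [mul_comm C m] at ht'
  have hpos : (0 : ℝ) < 2 ^ (m * C) := by positivity
  refine le_of_mul_le_mul_left (ht'.trans ?_) hpos
  calc _ ≤ (2 : ℝ) ^ m * (2 * (2 ^ (m * C) * (√(2 * ((L + 1) * Real.log 2)) * B *
        (∏ k, Mw k) * √(C * m)))) := by
        refine mul_le_mul_of_nonneg_left (mul_le_mul_of_nonneg_left ?_ two_pos.le) (by positivity)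
        exact key
    _ = _ := by ring

/-! ### McDiarmid's inequality -/

lemma abs_ciSup_le {κ : Type*} [Finite κ] [Nonempty κ] {a : κ → ℝ} {K : ℝ}
    (ha : ∀ k, |a k| ≤ K) : |⨆ k, a k| ≤ K := by
  obtain ⟨k, hk⟩ := exists_eq_ciSup_of_finite (f := a)
  rw [← hk]
  exact ha k

lemma le_ciSup_of_finite {κ : Type*} [Finite κ] (a : κ → ℝ) (k : κ) : a k ≤ ⨆ k, a k :=
  le_ciSup (Set.finite_range a).bddAbove k

lemma abs_ciSup_sub_ciSup_le {κ : Type*} [Finite κ] [Nonempty κ] {a b : κ → ℝ} {K : ℝ}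
    (hab : ∀ k, |a k - b k| ≤ K) : |(⨆ k, a k) - ⨆ k, b k| ≤ K := by
  rw [abs_sub_le_iff, sub_le_iff_le_add, sub_le_iff_le_add]
  constructor
  · refine ciSup_le fun k => ?_
    linarith [(abs_sub_le_iff.1 (hab k)).1, le_ciSup_of_finite b k]
  · refine ciSup_le fun k => ?_
    linarith [(abs_sub_le_iff.1 (hab k)).2, le_ciSup_of_finite a k]

lemma integrable_of_abs_le {Ω : Type*} [MeasurableSpace Ω] {μ : Measure Ω} [IsFiniteMeasure μ]
    {f : Ω → ℝ} (hf : Measurable f) {K : ℝ} (hK : ∀ ω, |f ω| ≤ K) : Integrable f μ :=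
  Integrable.of_bound hf.aestronglyMeasurable K (ae_of_all _ fun ω => by simpa using hK ω)

lemma abs_integral_le_of_abs_le {Ω : Type*} [MeasurableSpace Ω] {μ : Measure Ω}
    [IsProbabilityMeasure μ] {f : Ω → ℝ} {K : ℝ} (hK : ∀ ω, |f ω| ≤ K) : |∫ ω, f ω ∂μ| ≤ K := by
  simpa using norm_integral_le_of_norm_le_const (μ := μ) (f := f) (C := K) (ae_of_all _ hK)

lemma integral_pi_fin_succ {Z : Type*} [MeasurableSpace Z] {n : ℕ} (μ : Fin (n + 1) → Measure Z)
    [∀ i, IsProbabilityMeasure (μ i)] {G : (Fin (n + 1) → Z) → ℝ}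
    (hG : Measurable G) {K : ℝ} (hK : ∀ S, |G S| ≤ K) :
    ∫ S, G S ∂(Measure.pi μ) =
      ∫ z, ∫ S', G (Fin.cons z S') ∂(Measure.pi fun i => μ i.succ) ∂(μ 0) := by
  have h1 := (measurePreserving_piFinSuccAbove μ 0).symm
  rw [← h1.integral_comp', integral_prod]
  · simp only [MeasurableEquiv.piFinSuccAbove_symm_apply, Fin.insertNthEquiv_zero,
      Fin.succAbove_zero]
    rfl
  · exact integrable_of_abs_le (hG.comp (MeasurableEquiv.measurable _)) fun p => hK _

lemma measurable_cons {Z : Type*} [MeasurableSpace Z] {n : ℕ} :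
    Measurable fun p : Z × (Fin n → Z) => (Fin.cons p.1 p.2 : Fin (n + 1) → Z) := by
  refine measurable_pi_iff.2 fun i => ?_
  refine Fin.cases ?_ (fun i => ?_) i
  · simpa using measurable_fst
  · simp only [Fin.cons_succ]
    fun_prop

/-- Integrating out all coordinates but the first leaves a function `g` of oscillation at most `c`,
to which Hoeffding's lemma applies; for a fixed first coordinate the induction hypothesis handles
the fluctuation about `g`. -/
theorem integral_exp_bounded_differences_le {Z : Type*} [MeasurableSpace Z] {n : ℕ}
    (μ : Fin n → Measure Z) [∀ i, IsProbabilityMeasure (μ i)] {F : (Fin n → Z) → ℝ}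
    (hF : Measurable F) {K : ℝ} (hK : ∀ S, |F S| ≤ K) {c : ℝ} (hc0 : 0 ≤ c)
    (hc : ∀ S i z, |F (Function.update S i z) - F S| ≤ c) (t : ℝ) :
    ∫ S, Real.exp (t * (F S - ∫ S, F S ∂(Measure.pi μ))) ∂(Measure.pi μ) ≤
      Real.exp (n * (c / 2) ^ 2 * t ^ 2 / 2) := by
  induction n generalizing K with
  | zero =>
    have h1 : ∀ S : Fin 0 → Z, F S = F Fin.elim0 := fun S => congrArg F (Subsingleton.elim _ _)
    simp [h1]
  | succ n ih =>
    set ν := Measure.pi fun i : Fin n => μ i.succ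
    have hFc : Measurable fun p : Z × (Fin n → Z) => F (Fin.cons p.1 p.2) :=
      hF.comp measurable_cons
    have hFz : ∀ z, Measurable fun S' : Fin n → Z => F (Fin.cons z S') := fun z =>
      hFc.comp measurable_prodMk_left
    have hFzi : ∀ z, Integrable (fun S' : Fin n → Z => F (Fin.cons z S')) ν := fun z =>
      integrable_of_abs_le (hFz z) fun S' => hK _
    let g : Z → ℝ := fun z => ∫ S', F (Fin.cons z S') ∂ν
    have hgm : Measurable g := (hFc.stronglyMeasurable.integral_prod_right').measurable
    have hgK : ∀ z, |g z| ≤ K := fun z => abs_integral_le_of_abs_le fun S' => hK _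
    have hgd : ∀ z z', g z - g z' ≤ c := fun z z' => by
      rw [← integral_sub (hFzi z) (hFzi z')]
      calc _ ≤ ∫ _, c ∂ν := by
            refine integral_mono ((hFzi z).sub (hFzi z')) (integrable_const c) fun S' => ?_
            have := hc (Fin.cons z' S') 0 z
            rw [Fin.update_cons_zero] at this
            exact (le_abs_self _).trans this
        _ = c := by simp
    have hmean : ∫ S, F S ∂(Measure.pi μ) = ∫ z, g z ∂(μ 0) := integral_pi_fin_succ μ hF hK
    set I := ∫ S, F S ∂(Measure.pi μ)
    have hI : |I| ≤ K := abs_integral_le_of_abs_le hK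
    have hexpK : ∀ y, |y| ≤ K → |Real.exp (t * (y - I))| ≤ Real.exp (|t| * (K + K)) := by
      intro y hy
      rw [abs_of_pos (Real.exp_pos _)]
      refine Real.exp_le_exp.2 ((le_abs_self _).trans ?_)
      rw [abs_mul]
      exact mul_le_mul_of_nonneg_left ((abs_sub _ _).trans (add_le_add hy hI)) (abs_nonneg t)
    rw [integral_pi_fin_succ μ (by fun_prop) (fun S => hexpK _ (hK S))]
    have hinner : ∀ z, ∫ S', Real.exp (t * (F (Fin.cons z S') - I)) ∂ν ≤
        Real.exp (t * (g z - I)) * Real.exp (n * (c / 2) ^ 2 * t ^ 2 / 2) := by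
      intro z
      have := ih (fun i => μ i.succ) (hFz z) (fun S' => hK _) (fun S' i z' => by
        rw [Fin.cons_update]
        exact hc _ _ _)
      refine le_trans (le_of_eq ?_) (mul_le_mul_of_nonneg_left this (Real.exp_pos _).le)
      rw [← integral_const_mul]
      refine integral_congr_ae (ae_of_all _ fun S' => ?_)
      simp only [g, ← Real.exp_add]
      congr 1
      ring
    have hoeff : ∫ z, Real.exp (t * (g z - I)) ∂(μ 0) ≤ Real.exp ((c / 2) ^ 2 * t ^ 2 / 2) := by
      have : Nonempty Z := nonempty_of_isProbabilityMeasure (μ 0)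
      have hbdd : BddBelow (Set.range g) := ⟨-K, by
        rintro _ ⟨z, rfl⟩
        exact (abs_le.1 (hgK z)).1⟩
      have hmem : ∀ z, g z ∈ Set.Icc (⨅ z, g z) ((⨅ z, g z) + c) := fun z => by
        refine ⟨ciInf_le hbdd z, ?_⟩
        rw [← sub_le_iff_le_add]
        exact le_ciInf fun z' => by linarith [hgd z z']
      have := (hasSubgaussianMGF_of_mem_Icc hgm.aemeasurable
        (ae_of_all (μ 0) hmem)).mgf_le t
      rw [← hmean] at this
      simpa [mgf, abs_of_nonneg hc0] using this
    calc _ ≤ ∫ z, Real.exp (t * (g z - I)) * Real.exp (n * (c / 2) ^ 2 * t ^ 2 / 2) ∂(μ 0) := by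
          refine integral_mono_of_nonneg
            (ae_of_all _ fun z => integral_nonneg fun S' => (Real.exp_pos _).le)
            ?_ (ae_of_all _ hinner)
          exact (integrable_of_abs_le (by fun_prop) fun z => hexpK _ (hgK z)).mul_const _
      _ ≤ Real.exp ((c / 2) ^ 2 * t ^ 2 / 2) * Real.exp (n * (c / 2) ^ 2 * t ^ 2 / 2) := by
          rw [integral_mul_const]
          exact mul_le_mul_of_nonneg_right hoeff (Real.exp_pos _).le
      _ = _ := by
          rw [← Real.exp_add]
          congr 1
          push_cast
          ring

/-- **McDiarmid's inequality** for independent, not necessarily identically distributed draws. -/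
theorem measure_bounded_differences_ge_le {Z : Type*} [MeasurableSpace Z] {n : ℕ}
    (μ : Fin n → Measure Z) [∀ i, IsProbabilityMeasure (μ i)] {F : (Fin n → Z) → ℝ}
    (hF : Measurable F) {K : ℝ} (hK : ∀ S, |F S| ≤ K) {c : ℝ} (hc0 : 0 ≤ c)
    (hc : ∀ S i z, |F (Function.update S i z) - F S| ≤ c) {s : ℝ} (hs : 0 ≤ s) :
    (Measure.pi μ).real {S | s ≤ F S - ∫ S, F S ∂(Measure.pi μ)} ≤
      Real.exp (-s ^ 2 / (2 * (n * (c / 2) ^ 2))) := by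
  have hsub : HasSubgaussianMGF (fun S => F S - ∫ S, F S ∂(Measure.pi μ))
      (n * (c.toNNReal / 2) ^ 2) (Measure.pi μ) := by
    constructor
    · intro t
      set I := ∫ S, F S ∂(Measure.pi μ)
      refine integrable_of_abs_le (K := Real.exp (|t| * (K + |I|))) (by fun_prop) fun S => ?_
      rw [abs_of_pos (Real.exp_pos _)]
      refine Real.exp_le_exp.2 ((le_abs_self _).trans ?_)
      rw [abs_mul]
      exact mul_le_mul_of_nonneg_left ((abs_sub _ _).trans (add_le_add (hK S) le_rfl))
        (abs_nonneg t)
    · intro t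
      simpa [mgf, hc0] using integral_exp_bounded_differences_le μ hF hK hc0 hc t
  simpa [hc0] using hsub.measure_ge_le hs

/-! ### Symmetrization for independent, not identically distributed draws -/

section Symmetrization

set_option linter.unusedSectionVars false

variable {Z κ : Type*} [MeasurableSpace Z] [Finite κ] [Nonempty κ] {n : ℕ}

/-- The largest deviation of the mean loss from the total loss on a sample. -/
noncomputable def maxDeviation (μ : Fin n → Measure Z) (f : κ → Z → ℝ) (S : Fin n → Z) : ℝ :=
  ⨆ k, ∑ i, (∫ z, f k z ∂(μ i) - f k (S i))

/-- The largest signed difference of a sample and a ghost sample. -/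
noncomputable def maxGhostDifference (f : κ → Z → ℝ) (ε : Fin n → Bool) (P : Fin n → Z × Z) : ℝ :=
  ⨆ k, ∑ i, signVal (ε i) * (f k (P i).2 - f k (P i).1)

variable {f : κ → Z → ℝ} {M : ℝ}

lemma measurable_maxDeviation (μ : Fin n → Measure Z) (hf : ∀ k, Measurable (f k)) :
    Measurable (maxDeviation μ f) := by
  have : Countable κ := Finite.to_countable
  unfold maxDeviation
  fun_prop

lemma measurable_maxGhostDifference (hf : ∀ k, Measurable (f k)) (ε : Fin n → Bool) :
    Measurable (maxGhostDifference f ε) := by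
  have : Countable κ := Finite.to_countable
  unfold maxGhostDifference
  fun_prop

lemma integral_mem_Icc {μ : Measure Z} [IsProbabilityMeasure μ] {g : Z → ℝ} (hg : Measurable g)
    (hM : ∀ z, g z ∈ Set.Icc 0 M) : ∫ z, g z ∂μ ∈ Set.Icc 0 M := by
  refine ⟨integral_nonneg fun z => (hM z).1, ?_⟩
  have hi : Integrable g μ := integrable_of_abs_le hg fun z => by
    rw [abs_of_nonneg (hM z).1]; exact (hM z).2
  calc ∫ z, g z ∂μ ≤ ∫ _, M ∂μ := integral_mono hi (integrable_const M) fun z => (hM z).2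
    _ = M := by simp

lemma abs_sub_le_of_mem_Icc {a b : ℝ} (ha : a ∈ Set.Icc 0 M) (hb : b ∈ Set.Icc 0 M) :
    |a - b| ≤ M := by
  rw [abs_sub_le_iff]
  constructor <;> linarith [ha.1, ha.2, hb.1, hb.2]

lemma abs_maxDeviation_le (μ : Fin n → Measure Z) [∀ i, IsProbabilityMeasure (μ i)]
    (hf : ∀ k, Measurable (f k)) (hM : ∀ k z, f k z ∈ Set.Icc 0 M) (S : Fin n → Z) :
    |maxDeviation μ f S| ≤ n * M := by
  refine abs_ciSup_le fun k => ?_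
  refine (Finset.abs_sum_le_sum_abs _ _).trans ?_
  calc _ ≤ ∑ _i : Fin n, M := Finset.sum_le_sum fun i _ =>
        abs_sub_le_of_mem_Icc (integral_mem_Icc (hf k) (hM k)) (hM k _)
    _ = n * M := by simp

lemma abs_maxGhostDifference_le (hM : ∀ k z, f k z ∈ Set.Icc 0 M) (ε : Fin n → Bool)
    (P : Fin n → Z × Z) : |maxGhostDifference f ε P| ≤ n * M := by
  refine abs_ciSup_le fun k => ?_
  refine (Finset.abs_sum_le_sum_abs _ _).trans ?_
  calc _ ≤ ∑ _i : Fin n, M := Finset.sum_le_sum fun i _ => by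
        rw [abs_mul]
        have : |signVal (ε i)| = 1 := by cases ε i <;> simp
        rw [this, one_mul]
        exact abs_sub_le_of_mem_Icc (hM k _) (hM k _)
    _ = n * M := by simp

lemma abs_maxDeviation_update_sub_le (μ : Fin n → Measure Z)
    (hM : ∀ k z, f k z ∈ Set.Icc 0 M) (S : Fin n → Z) (i : Fin n) (z : Z) :
    |maxDeviation μ f (Function.update S i z) - maxDeviation μ f S| ≤ M := by
  refine abs_ciSup_sub_ciSup_le fun k => ?_
  rw [← Finset.sum_sub_distrib, Finset.sum_eq_single i]
  · rw [Function.update_self, sub_sub_sub_cancel_left]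
    exact abs_sub_le_of_mem_Icc (hM k _) (hM k _)
  · intro j _ hj
    simp [Function.update_of_ne hj]
  · simp

/-- The means are integrals over an independent second sample, and a maximum of integrals is at most
the integral of the maximum. -/
theorem integral_maxDeviation_le_ghost (μ : Fin n → Measure Z) [∀ i, IsProbabilityMeasure (μ i)]
    (hf : ∀ k, Measurable (f k)) (hM : ∀ k z, f k z ∈ Set.Icc 0 M) :
    ∫ S, maxDeviation μ f S ∂(Measure.pi μ) ≤
      ∫ P, maxGhostDifference f (fun _ => true) P ∂(Measure.pi fun i => (μ i).prod (μ i)) := by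
  have hmp := (measurePreserving_arrowProdEquivProdArrow Z Z (Fin n) μ μ).symm
  rw [← hmp.integral_comp', integral_prod]
  swap
  · exact integrable_of_abs_le
      ((measurable_maxGhostDifference hf _).comp (MeasurableEquiv.measurable _))
      fun p => abs_maxGhostDifference_le hM _ _
  have hm : Measurable fun p : (Fin n → Z) × (Fin n → Z) =>
      maxGhostDifference f (fun _ => true)
        ((MeasurableEquiv.arrowProdEquivProdArrow Z Z (Fin n)).symm p) :=
    (measurable_maxGhostDifference hf _).comp (MeasurableEquiv.measurable _)
  refine integral_mono
    (integrable_of_abs_le (measurable_maxDeviation μ hf) (abs_maxDeviation_le μ hf hM)) ?_ ?_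
  · refine integrable_of_abs_le (K := n * M)
      (hm.stronglyMeasurable.integral_prod_right').measurable fun S => ?_
    exact abs_integral_le_of_abs_le fun S' => abs_maxGhostDifference_le hM _ _
  · intro S
    refine ciSup_le fun k => ?_
    have hfi : ∀ i, Integrable (f k) (μ i) := fun i => integrable_of_abs_le (hf k) fun z => by
      rw [abs_of_nonneg (hM k z).1]; exact (hM k z).2
    have hfe : ∀ i : Fin n, Integrable (fun S' : Fin n → Z => f k (S' i)) (Measure.pi μ) :=
      fun i => (measurePreserving_eval μ i).integrable_comp_of_integrable (hfi i)
    have e : ∑ i, (∫ z, f k z ∂(μ i) - f k (S i)) =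
        ∫ S', ∑ i, (f k (S' i) - f k (S i)) ∂(Measure.pi μ) := by
      rw [integral_finsetSum Finset.univ (f := fun i (S' : Fin n → Z) => f k (S' i) - f k (S i))
        fun i _ => (hfe i).sub (integrable_const _)]
      refine Finset.sum_congr rfl fun i _ => ?_
      rw [integral_sub (hfe i) (integrable_const _)]
      have := integral_map (μ := Measure.pi μ) (measurePreserving_eval μ i).measurable.aemeasurable
        (f := f k) (hf k).aestronglyMeasurable
      rw [(measurePreserving_eval μ i).map_eq] at this
      rw [this]
      simp [Function.eval]
    rw [e]
    refine integral_mono (integrable_finsetSum _ fun i _ => (hfe i).sub (integrable_const _))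
      (integrable_of_abs_le (hm.comp measurable_prodMk_left)
        fun S' => abs_maxGhostDifference_le hM _ _) fun S' => ?_
    have := le_ciSup_of_finite (fun k => ∑ i, (f k (S' i) - f k (S i))) k
    refine this.trans (le_of_eq ?_)
    simp [maxGhostDifference, MeasurableEquiv.arrowProdEquivProdArrow,
      Equiv.arrowProdEquivProdArrow]

/-- A negative sign at `i` swaps the two points of the `i`-th pair, which have the same law;
different pairs need not. -/
theorem integral_maxGhostDifference_eq (μ : Fin n → Measure Z) [∀ i, IsProbabilityMeasure (μ i)]
    (hf : ∀ k, Measurable (f k)) (ε : Fin n → Bool) :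
    ∫ P, maxGhostDifference f ε P ∂(Measure.pi fun i => (μ i).prod (μ i)) =
      ∫ P, maxGhostDifference f (fun _ => true) P ∂(Measure.pi fun i => (μ i).prod (μ i)) := by
  let s : Fin n → Z × Z → Z × Z := fun i => if ε i then id else Prod.swap
  have hs : ∀ i, MeasurePreserving (s i) ((μ i).prod (μ i)) ((μ i).prod (μ i)) := by
    intro i
    by_cases h : ε i
    · simp only [s, h, if_true]; exact MeasurePreserving.id _
    · simp only [s, h]; exact Measure.measurePreserving_swap
  have hmp := measurePreserving_pi (fun i => (μ i).prod (μ i)) (fun i => (μ i).prod (μ i)) hs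
  have := integral_map (μ := Measure.pi fun i => (μ i).prod (μ i)) hmp.measurable.aemeasurable
    (f := maxGhostDifference f fun _ => true)
    (measurable_maxGhostDifference hf _).aestronglyMeasurable
  rw [hmp.map_eq] at this
  rw [this]
  refine integral_congr_ae (ae_of_all _ fun P => ?_)
  simp only [maxGhostDifference]
  refine iSup_congr fun k => Finset.sum_congr rfl fun i _ => ?_
  cases h : ε i <;> simp [s, h]

lemma sum_maxGhostDifference_le (f : κ → Z → ℝ) (P : Fin n → Z × Z) :
    ∑ ε : Fin n → Bool, maxGhostDifference f ε P ≤
      (∑ ε : Fin n → Bool, ⨆ k, ∑ i, signVal (ε i) * f k (P i).1) +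
        ∑ ε : Fin n → Bool, ⨆ k, ∑ i, signVal (ε i) * f k (P i).2 := by
  rw [← sum_comp_not (fun ε : Fin n → Bool => ⨆ k, ∑ i, signVal (ε i) * f k (P i).1),
    ← Finset.sum_add_distrib]
  refine Finset.sum_le_sum fun ε _ => ciSup_le fun k => ?_
  have h1 := le_ciSup_of_finite (fun k => ∑ i, signVal (!ε i) * f k (P i).1) k
  have h2 := le_ciSup_of_finite (fun k => ∑ i, signVal (ε i) * f k (P i).2) k
  refine le_trans (le_of_eq ?_) (add_le_add h1 h2)
  rw [← Finset.sum_add_distrib]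
  exact Finset.sum_congr rfl fun i _ => by rw [signVal_not]; ring

/-- **Symmetrization**: the expected deviation is at most twice the Rademacher average. -/
theorem integral_maxDeviation_le (μ : Fin n → Measure Z) [∀ i, IsProbabilityMeasure (μ i)]
    (hf : ∀ k, Measurable (f k)) (hM : ∀ k z, f k z ∈ Set.Icc 0 M) {K : ℝ}
    (hK : ∀ᵐ S ∂(Measure.pi μ),
      ∑ ε : Fin n → Bool, ⨆ k, ∑ i, signVal (ε i) * f k (S i) ≤ 2 ^ n * K) :
    ∫ S, maxDeviation μ f S ∂(Measure.pi μ) ≤ 2 * K := by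
  refine (integral_maxDeviation_le_ghost μ hf hM).trans ?_
  set Q := Measure.pi fun i => (μ i).prod (μ i)
  have hi : ∀ ε, Integrable (maxGhostDifference f ε) Q := fun ε =>
    integrable_of_abs_le (measurable_maxGhostDifference hf ε) (abs_maxGhostDifference_le hM ε)
  have hfst := measurePreserving_pi (fun i => (μ i).prod (μ i)) μ
    (fun i => measurePreserving_fst (μ := μ i) (ν := μ i))
  have hsnd := measurePreserving_pi (fun i => (μ i).prod (μ i)) μ
    (fun i => measurePreserving_snd (μ := μ i) (ν := μ i))
  have hae : ∀ᵐ P ∂Q, ∑ ε : Fin n → Bool, maxGhostDifference f ε P ≤ 2 ^ n * (2 * K) := by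
    filter_upwards [hfst.quasiMeasurePreserving.ae hK, hsnd.quasiMeasurePreserving.ae hK]
      with P h1 h2
    have := sum_maxGhostDifference_le f P
    linarith
  have h1 := integral_mono_ae (integrable_finsetSum Finset.univ fun ε _ => hi ε)
    (integrable_const _) hae
  rw [integral_finsetSum _ fun ε _ => hi ε] at h1
  simp only [Q, integral_maxGhostDifference_eq μ hf] at h1
  simp only [Finset.sum_const, Finset.card_univ, Fintype.card_pi, Fintype.card_bool,
    Finset.prod_const, Fintype.card_fin, nsmul_eq_mul, Nat.cast_pow, Nat.cast_ofNat,
    integral_const, probReal_univ, smul_eq_mul, one_mul] at h1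
  exact le_of_mul_le_mul_left h1 (by positivity)

/-- Uniform deviation bound for a finite family of bounded losses. -/
theorem le_measure_forall_sum_sub_le (μ : Fin n → Measure Z) [∀ i, IsProbabilityMeasure (μ i)]
    (hn : 0 < n) (hf : ∀ k, Measurable (f k)) (hM : ∀ k z, f k z ∈ Set.Icc 0 M) {K : ℝ}
    (hK0 : 0 ≤ K)
    (hK : ∀ᵐ S ∂(Measure.pi μ),
      ∑ ε : Fin n → Bool, ⨆ k, ∑ i, signVal (ε i) * f k (S i) ≤ 2 ^ n * K)
    {δ : ℝ} (hδ : δ ∈ Set.Ioo (0 : ℝ) 1) :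
    ENNReal.ofReal (1 - δ) ≤ Measure.pi μ {S | ∀ k,
      ∑ i, ∫ z, f k z ∂(μ i) - ∑ i, f k (S i) ≤ 2 * K + M * √(n * Real.log (1 / δ) / 2)} := by
  have hlog : 0 < Real.log (1 / δ) := Real.log_pos (by rw [one_lt_div hδ.1]; exact hδ.2)
  obtain ⟨z0⟩ := nonempty_of_isProbabilityMeasure (μ ⟨0, hn⟩)
  have hM0 : 0 ≤ M := (hM (Classical.arbitrary κ) z0).1.trans (hM _ z0).2
  -- For `M = 0` the losses vanish; the tail computation below divides by `M`.
  rcases hM0.eq_or_lt with rfl | hMpos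
  · have hfz : ∀ k z, f k z = 0 := fun k z => le_antisymm (hM k z).2 (hM k z).1
    have : {S : Fin n → Z | ∀ k, ∑ i, ∫ z, f k z ∂(μ i) - ∑ i, f k (S i) ≤
        2 * K + 0 * √(n * Real.log (1 / δ) / 2)} = Set.univ := by
      refine Set.eq_univ_of_forall fun S k => ?_
      simp [hfz, hK0]
    rw [this, measure_univ, ENNReal.ofReal_le_one]
    linarith [hδ.1]
  set s := M * √(n * Real.log (1 / δ) / 2)
  have hs : 0 ≤ s := by positivity
  have hn' : (0 : ℝ) < n := by exact_mod_cast hn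
  have hmd := measure_bounded_differences_ge_le μ (measurable_maxDeviation μ hf)
    (abs_maxDeviation_le μ hf hM) hM0 (abs_maxDeviation_update_sub_le μ hM) hs
  -- The threshold `s` is chosen to make McDiarmid's tail exactly `δ`.
  have hexp : Real.exp (-s ^ 2 / (2 * (n * (M / 2) ^ 2))) = δ := by
    rw [mul_pow, Real.sq_sqrt (by positivity)]
    have : -(M ^ 2 * (n * Real.log (1 / δ) / 2)) / (2 * (n * (M / 2) ^ 2)) = Real.log δ := by
      rw [one_div, Real.log_inv]
      field_simp
    rw [this, Real.exp_log hδ.1]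
  rw [hexp] at hmd
  set bad := {S | s ≤ maxDeviation μ f S - ∫ S, maxDeviation μ f S ∂(Measure.pi μ)} with hbad
  have hbm : MeasurableSet bad :=
    measurableSet_le measurable_const ((measurable_maxDeviation μ hf).sub_const _)
  have hsub : badᶜ ⊆ {S | ∀ k, ∑ i, ∫ z, f k z ∂(μ i) - ∑ i, f k (S i) ≤ 2 * K + s} := by
    intro S hS k
    have h1 : maxDeviation μ f S - ∫ S, maxDeviation μ f S ∂(Measure.pi μ) < s := not_le.1 hS
    have h2 := integral_maxDeviation_le μ hf hM hK
    have h3 := le_ciSup_of_finite (fun k => ∑ i, (∫ z, f k z ∂(μ i) - f k (S i))) k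
    change _ ≤ maxDeviation μ f S at h3
    rw [← Finset.sum_sub_distrib]
    linarith
  refine le_trans ?_ (measure_mono hsub)
  rw [prob_compl_eq_one_sub hbm, ENNReal.ofReal_sub _ hδ.1.le, ENNReal.ofReal_one]
  refine tsub_le_tsub_left ?_ _
  rw [← ofReal_measureReal]
  exact ENNReal.ofReal_le_ofReal hmd

end Symmetrization

/-! ### From finite families to the whole class -/

open Filter Topology

/-- Networks parametrized by a pair of families of real numbers, a second-countable space. -/
def Weights.ofPair (p : ((i : Fin L) → Fin (h (i + 1)) → Fin (h i) → ℝ) ×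
    (Fin C × Fin C → Fin (h L) → ℝ)) : Weights C L h :=
  ⟨fun i => Matrix.of (p.1 i), Matrix.of p.2⟩

lemma Weights.continuous_feature_ofPair {σ : Fin L → ℝ → ℝ} (hσ : ∀ i, Continuous (σ i)) (i : ℕ)
    (hi : i ≤ L) : Continuous fun q : (((i : Fin L) → Fin (h (i + 1)) → Fin (h i) → ℝ) ×
      (Fin C × Fin C → Fin (h L) → ℝ)) × EuclideanSpace ℝ (Fin (h 0)) =>
        (Weights.ofPair q.1).feature σ q.2 i hi := by
  induction i with
  | zero =>
    simp only [Weights.feature]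
    fun_prop
  | succ i ih =>
    have ih' := ih (Nat.le_of_succ_le hi)
    refine continuous_pi fun r => ?_
    simp only [Weights.feature, Weights.ofPair, Matrix.mulVec, dotProduct, Matrix.of_apply]
    refine (hσ _).comp (continuous_finsetSum _ fun s _ => ?_)
    exact Continuous.mul (by fun_prop) ((continuous_apply s).comp ih')

lemma Weights.continuous_loss_ofPair {σ : Fin L → ℝ → ℝ} (hσ : ∀ i, Continuous (σ i))
    (y a : Fin C) : Continuous fun q : (((i : Fin L) → Fin (h (i + 1)) → Fin (h i) → ℝ) ×
      (Fin C × Fin C → Fin (h L) → ℝ)) × EuclideanSpace ℝ (Fin (h 0)) =>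
        (Weights.ofPair q.1).loss σ (q.2, y, a) := by
  have : Nonempty (Fin C) := ⟨y⟩
  have hnet : ∀ a b, Continuous fun q : (((i : Fin L) → Fin (h (i + 1)) → Fin (h i) → ℝ) ×
      (Fin C × Fin C → Fin (h L) → ℝ)) × EuclideanSpace ℝ (Fin (h 0)) =>
        (Weights.ofPair q.1).net σ q.2 a b := by
    intro a b
    simp only [Weights.net, Matrix.mulVec, dotProduct, Matrix.of_apply]
    refine continuous_finsetSum _ fun s _ => Continuous.mul ?_
      ((continuous_apply s).comp (Weights.continuous_feature_ofPair hσ L le_rfl))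
    simp only [Weights.ofPair, Matrix.of_apply]
    fun_prop
  simp only [Weights.loss_eq]
  refine Continuous.sub (Continuous.log ?_ fun q => ?_) (hnet a y)
  · exact continuous_finsetSum _ fun k _ => Real.continuous_exp.comp (hnet a k)
  · exact (Finset.sum_pos (fun k _ => Real.exp_pos _) Finset.univ_nonempty).ne'

lemma Weights.measurable_loss (W : Weights C L h) {σ : Fin L → ℝ → ℝ}
    (hσ : ∀ i, Continuous (σ i)) : Measurable (W.loss σ) := by
  refine measurable_from_prod_countable_left fun ya => ?_
  have := (Weights.continuous_loss_ofPair (C := C) (h := h) hσ ya.1 ya.2).comp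
    (Continuous.prodMk_right ((fun i => W.hidden i, W.output)))
  exact this.measurable

lemma Weights.measurable_empiricalRisk (W : Weights C L h) {σ : Fin L → ℝ → ℝ}
    (hσ : ∀ i, Continuous (σ i)) (m : ℕ) :
    Measurable fun S : Fin m → DataPoint (h 0) C => W.empiricalRisk σ S := by
  have := W.measurable_loss hσ
  unfold Weights.empiricalRisk
  fun_prop

/-- The class of bounded networks has a sequence that is dense with respect to pointwise
convergence of the losses. -/
lemma exists_seq_dense_frobeniusBounded {σ : Fin L → ℝ → ℝ} (hσ : ∀ i, Continuous (σ i))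
    {Mw : Fin (L + 1) → ℝ} (hne : ∃ W : Weights C L h, W.FrobeniusBounded Mw) :
    ∃ u : ℕ → Weights C L h, (∀ n, (u n).FrobeniusBounded Mw) ∧
      ∀ W : Weights C L h, W.FrobeniusBounded Mw → ∃ φ : ℕ → ℕ, ∀ z,
        Tendsto (fun n => (u (φ n)).loss σ z) atTop (𝓝 (W.loss σ z)) := by
  let P := {p : ((i : Fin L) → Fin (h (i + 1)) → Fin (h i) → ℝ) ×
    (Fin C × Fin C → Fin (h L) → ℝ) // (Weights.ofPair p).FrobeniusBounded Mw}
  obtain ⟨W0, hW0⟩ := hne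
  have : Nonempty P := ⟨⟨(fun i => W0.hidden i, W0.output), hW0⟩⟩
  obtain ⟨u, hu⟩ := TopologicalSpace.exists_dense_seq P
  refine ⟨fun n => Weights.ofPair (u n).1, fun n => (u n).2, fun W hW => ?_⟩
  obtain ⟨v, hv, hvW⟩ := mem_closure_iff_seq_limit.1
    (hu ⟨(fun i => W.hidden i, W.output), hW⟩)
  choose φ hφ using hv
  refine ⟨φ, fun z => ?_⟩
  have h1 := (Weights.continuous_loss_ofPair (C := C) (h := h) hσ z.2.1 z.2.2).tendsto
    ((fun i => W.hidden i, W.output), z.1)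
  have h2 : Tendsto (fun n => ((v n).1, z.1)) atTop
      (𝓝 (((fun i => W.hidden i, W.output) : ((i : Fin L) → Fin (h (i + 1)) → Fin (h i) → ℝ) ×
        (Fin C × Fin C → Fin (h L) → ℝ)), z.1)) :=
    ((continuous_subtype_val.tendsto _).comp hvW).prodMk_nhds tendsto_const_nhds
  have h3 := h1.comp h2
  simp only [← hφ] at h3
  exact h3

/-- Deviation bounds for finite families of networks give uniform deviation bounds. -/
theorem le_measure_forall_risk_sub_le {σ : Fin L → ℝ → ℝ} (hσ : ∀ i, Continuous (σ i))
    {Mw : Fin (L + 1) → ℝ} {M : ℝ} (D : Measure (DataPoint (h 0) C)) [IsProbabilityMeasure D]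
    (hM : ∀ W : Weights C L h, W.FrobeniusBounded Mw → ∀ᵐ z ∂D, W.loss σ z ≤ M) {m : ℕ}
    (ν : Measure (Fin m → DataPoint (h 0) C)) [IsProbabilityMeasure ν] {b : ℝ} {a : ℝ≥0∞}
    (ha : a ≤ 1)
    (hν : ∀ (n : ℕ) (u : Fin (n + 1) → Weights C L h), (∀ k, (u k).FrobeniusBounded Mw) →
      a ≤ ν {S | ∀ k, (u k).risk σ D - (u k).empiricalRisk σ S ≤ b}) :
    a ≤ ν {S | ∀ W : Weights C L h, W.FrobeniusBounded Mw →
      W.risk σ D - W.empiricalRisk σ S ≤ b} := by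
  by_cases hne : ∃ W : Weights C L h, W.FrobeniusBounded Mw
  swap
  · push Not at hne
    have : {S : Fin m → DataPoint (h 0) C | ∀ W : Weights C L h, W.FrobeniusBounded Mw →
        W.risk σ D - W.empiricalRisk σ S ≤ b} = Set.univ :=
      Set.eq_univ_of_forall fun S W hW => absurd hW (hne W)
    rwa [this, measure_univ]
  obtain ⟨u, hu, hdense⟩ := exists_seq_dense_frobeniusBounded hσ hne
  -- These measurable events decrease, so their intersection keeps the lower bound `a`. The uniform
  -- event need not be measurable: containing the intersection suffices.
  let A : ℕ → Set (Fin m → DataPoint (h 0) C) := fun n =>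
    {S | ∀ k : Fin (n + 1), (u k).risk σ D - (u k).empiricalRisk σ S ≤ b}
  have hAm : ∀ n, MeasurableSet (A n) := fun n => by
    simp only [A, Set.ofPred_forall]
    exact MeasurableSet.iInter fun k => measurableSet_le
      (measurable_const.sub ((u k).measurable_empiricalRisk hσ m)) measurable_const
  have hAanti : Antitone A := fun n n' hnn' S hS k => hS ⟨k, by omega⟩
  have hlim := tendsto_measure_iInter_atTop (μ := ν) (fun n => (hAm n).nullMeasurableSet) hAanti
    ⟨0, measure_ne_top ν _⟩
  have h1 : a ≤ ν (⋂ n, A n) :=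
    ge_of_tendsto' hlim fun n => hν n (fun k => u k) fun k => hu k
  refine h1.trans (measure_mono fun S hS W hW => ?_)
  obtain ⟨φ, hφ⟩ := hdense W hW
  have hemp : Tendsto (fun n => (u (φ n)).empiricalRisk σ S) atTop (𝓝 (W.empiricalRisk σ S)) :=
    (tendsto_finsetSum _ fun i _ => hφ (S i)).div_const _
  have hrisk : Tendsto (fun n => (u (φ n)).risk σ D) atTop (𝓝 (W.risk σ D)) := by
    refine tendsto_integral_of_dominated_convergence (fun _ => M)
      (fun n => ((u (φ n)).measurable_loss hσ).aestronglyMeasurable) (integrable_const M)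
      (fun n => ?_) (ae_of_all _ hφ)
    filter_upwards [hM _ (hu (φ n))] with z hz
    rwa [Real.norm_of_nonneg (Weights.loss_nonneg _ _ _)]
  refine le_of_tendsto' (hrisk.sub hemp) fun n => ?_
  exact Set.mem_iInter.1 hS (φ n) ⟨φ n, Nat.lt_succ_self _⟩

/-! ### The deviation bound for finite families -/

/-- Since `√(C m) = C m / √(C m)`, the bound of `sum_sign_loss_le` carries `2 C` where `C²` is
allowed, which needs `C ≥ 2`. For a single class the softmax is 1 and the loss 0. -/
theorem sum_sign_loss_le_genBound {σ : Fin L → ℝ → ℝ} (hσ_lip : ∀ i, LipschitzWith 1 (σ i))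
    (hσ_hom : ∀ i, ∀ a : ℝ, 0 < a → ∀ u : ℝ, σ i (a * u) = a * σ i u)
    (Mw : Fin (L + 1) → ℝ) (hMw : ∀ i, 0 ≤ Mw i) {B : ℝ} (hB : 0 ≤ B) {m : ℕ} (hm : 0 < m)
    (S : Fin m → DataPoint (h 0) C)
    (hS : ∀ i, ‖(S i).1‖ ≤ B) (hC : 0 < C) (W : (Fin m → Bool) → Weights C L h)
    (hW : ∀ ε, (W ε).FrobeniusBounded Mw) :
    ∑ ε : Fin m → Bool, ∑ i, signVal (ε i) * (W ε).loss σ (S i) ≤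
      2 ^ m * ((C : ℝ) ^ 2 * B * (√(2 * (L + 1 : ℕ) * Real.log 2) + 1) * (∏ i, Mw i) /
        √((C : ℝ) * m) * m) := by
  have hC' : (0 : ℝ) < C := by exact_mod_cast hC
  have hm' : (0 : ℝ) < m := by exact_mod_cast hm
  have hprod : 0 ≤ ∏ i, Mw i := Finset.prod_nonneg fun i _ => hMw i
  rcases Nat.lt_or_ge 1 C with hC1 | hC1
  · have : Nonempty (Fin C) := ⟨⟨0, hC⟩⟩
    refine (sum_sign_loss_le hσ_lip hσ_hom Mw hB S hS W hW).trans ?_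
    refine mul_le_mul_of_nonneg_left ?_ (by positivity)
    have hC2 : (2 : ℝ) ≤ C := by exact_mod_cast hC1
    set r := √(2 * ((L + 1 : ℕ) : ℝ) * Real.log 2)
    have hr : √(2 * (((L : ℝ) + 1) * Real.log 2)) = r := by
      simp only [r]; push_cast; rw [mul_assoc]
    have hr0 : 0 ≤ r := Real.sqrt_nonneg _
    have hs : √((C : ℝ) * m) ^ 2 = C * m := Real.sq_sqrt (by positivity)
    have hs0 : 0 < √((C : ℝ) * m) := Real.sqrt_pos.2 (by positivity)
    rw [hr, div_mul_eq_mul_div, le_div_iff₀ hs0]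
    calc 2 * (r * B * (∏ k, Mw k) * √(C * m)) * √(C * m)
        = 2 * (C * (r * (B * (∏ k, Mw k) * m))) := by
          rw [mul_assoc, mul_assoc (r * B * _), ← sq, hs]; ring
      _ ≤ C * (C * ((r + 1) * (B * (∏ k, Mw k) * m))) := by
          gcongr
          linarith
      _ = _ := by ring
  · obtain rfl : C = 1 := by omega
    have hloss : ∀ (W : Weights 1 L h) z, W.loss σ z = 0 := by
      intro W z
      rw [W.loss_eq, Fin.sum_univ_one, Real.log_exp, Subsingleton.elim z.2.1 0, sub_self]
    simp only [hloss, mul_zero, Finset.sum_const_zero]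
    positivity

/-- The deviation bound for a finite family of networks and a sample of independent data points
whose distributions average to `D`. -/
theorem le_pi_forall_risk_sub_le {σ : Fin L → ℝ → ℝ} (hσ_lip : ∀ i, LipschitzWith 1 (σ i))
    (hσ_hom : ∀ i, ∀ a : ℝ, 0 < a → ∀ u : ℝ, σ i (a * u) = a * σ i u)
    {X : Set (EuclideanSpace ℝ (Fin (h 0)))} {B : ℝ} (hB : ∀ x ∈ X, ‖x‖ ≤ B)
    {Mw : Fin (L + 1) → ℝ} {M : ℝ}
    (hM : ∀ W : Weights C L h, W.FrobeniusBounded Mw →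
      ∀ x ∈ X, ∀ ybar ystar : Fin C, W.loss σ (x, ybar, ystar) ≤ M)
    {m : ℕ} (hm : 0 < m) (D : Measure (DataPoint (h 0) C))
    (μ : Fin m → Measure (DataPoint (h 0) C)) [∀ i, IsProbabilityMeasure (μ i)]
    (hX : ∀ i, ∀ᵐ z ∂(μ i), z.1 ∈ X)
    (hD : ∀ W : Weights C L h, W.FrobeniusBounded Mw →
      ∑ i, ∫ z, W.loss σ z ∂(μ i) = m * W.risk σ D)
    {δ : ℝ} (hδ : δ ∈ Set.Ioo (0 : ℝ) 1) {n : ℕ} (u : Fin (n + 1) → Weights C L h)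
    (hu : ∀ k, (u k).FrobeniusBounded Mw) :
    ENNReal.ofReal (1 - δ) ≤ Measure.pi μ
      {S | ∀ k, (u k).risk σ D - (u k).empiricalRisk σ S ≤ genBound C B Mw M m δ} := by
  have hσ : ∀ i, Continuous (σ i) := fun i => (hσ_lip i).continuous
  have hm' : (0 : ℝ) < m := by exact_mod_cast hm
  obtain ⟨z0, hz0⟩ := (hX ⟨0, hm⟩).exists
  have hB0 : 0 ≤ B := (norm_nonneg _).trans (hB _ hz0)
  have hC : 0 < C := z0.2.1.pos
  have hMw : ∀ i, 0 ≤ Mw i := by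
    intro i
    refine Fin.lastCases ?_ (fun i => ?_) i
    · exact (norm_nonneg _).trans (hu 0).2
    · exact (norm_nonneg _).trans ((hu 0).1 i)
  have hM0 : 0 ≤ M := ((u 0).loss_nonneg σ z0).trans (hM _ (hu 0) _ hz0 _ _)
  have hprod : 0 ≤ ∏ i, Mw i := Finset.prod_nonneg fun i _ => hMw i
  set K := (C : ℝ) ^ 2 * B * (√(2 * (L + 1 : ℕ) * Real.log 2) + 1) * (∏ i, Mw i) /
    √((C : ℝ) * m) * m with hK
  have hK0 : 0 ≤ K := by positivity
  -- The loss is bounded by `M` only for inputs in `X`; truncation makes the bound hold everywhere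
  -- and changes nothing almost surely.
  let f : Fin (n + 1) → DataPoint (h 0) C → ℝ := fun k z => min ((u k).loss σ z) M
  have hfm : ∀ k, Measurable (f k) := fun k => ((u k).measurable_loss hσ).min measurable_const
  have hf : ∀ k z, f k z ∈ Set.Icc 0 M := fun k z =>
    ⟨le_min ((u k).loss_nonneg σ z) hM0, min_le_right _ _⟩
  have hfX : ∀ k z, z.1 ∈ X → f k z = (u k).loss σ z := fun k z hz =>
    min_eq_left (hM _ (hu k) _ hz _ _)
  have hSX : ∀ᵐ S ∂(Measure.pi μ), ∀ i, (S i).1 ∈ X := by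
    rw [ae_all_iff]
    exact fun i => (measurePreserving_eval μ i).quasiMeasurePreserving.ae (hX i)
  have hrad : ∀ᵐ S ∂(Measure.pi μ),
      ∑ ε : Fin m → Bool, ⨆ k, ∑ i, signVal (ε i) * f k (S i) ≤ 2 ^ m * K := by
    filter_upwards [hSX] with S hS
    have hsel : ∀ ε : Fin m → Bool, ∃ k, ∑ i, signVal (ε i) * f k (S i) =
        ⨆ k, ∑ i, signVal (ε i) * f k (S i) := fun ε => exists_eq_ciSup_of_finite
    choose k hk using hsel
    rw [← Finset.sum_congr rfl fun ε _ => hk ε]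
    simp only [hfX _ _ (hS _)]
    exact sum_sign_loss_le_genBound hσ_lip hσ_hom Mw hMw hB0 hm S (fun i => hB _ (hS i)) hC
      (fun ε => u (k ε)) (fun ε => hu (k ε))
  refine (le_measure_forall_sum_sub_le μ hm hfm hf hK0 hrad hδ).trans (measure_mono_ae ?_)
  filter_upwards [hSX] with S hS hgood
  intro k
  have hk := hgood k
  simp only [hfX _ _ (hS _)] at hk
  have hint : ∀ i, ∫ z, f k z ∂(μ i) = ∫ z, (u k).loss σ z ∂(μ i) := fun i =>
    integral_congr_ae ((hX i).mono fun z hz => hfX k z hz)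
  simp only [hint] at hk
  rw [hD _ (hu k)] at hk
  have hsqrt : √(m * Real.log (1 / δ) / 2) = m * √(Real.log (1 / δ) / (2 * m)) := by
    rw [show (m : ℝ) * Real.log (1 / δ) / 2 = m ^ 2 * (Real.log (1 / δ) / (2 * m)) by
      field_simp, Real.sqrt_mul (sq_nonneg _), Real.sqrt_sq hm'.le]
  rw [hsqrt] at hk
  have hgen : m * genBound C B Mw M m δ = 2 * K + M * (m * √(Real.log (1 / δ) / (2 * m))) := by
    rw [genBound, hK]; ring
  rw [← hgen] at hk
  refine le_of_mul_le_mul_left ?_ hm'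
  rw [mul_sub, Weights.empiricalRisk, mul_div_cancel₀ _ hm'.ne']
  exact hk


/-! ### Conditioning on class balance -/

lemma le_cond_biUnion {Ω ι : Type*} [MeasurableSpace Ω] (P : Measure Ω) [IsFiniteMeasure P]
    (s : Finset ι) {E : ι → Set Ω} (hE : ∀ i, MeasurableSet (E i))
    (hd : Pairwise (Function.onFun Disjoint E)) {A : Set Ω} (hA : MeasurableSet A) {a : ℝ≥0∞}
    (ha : ∀ i ∈ s, a ≤ P[|E i] A) (hne : P (⋃ i ∈ s, E i) ≠ 0) :
    a ≤ P[|⋃ i ∈ s, E i] A := by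
  have hm : MeasurableSet (⋃ i ∈ s, E i) := s.measurableSet_biUnion fun i _ => hE i
  have h1 : a * P (⋃ i ∈ s, E i) ≤ P ((⋃ i ∈ s, E i) ∩ A) := by
    rw [Set.iUnion₂_inter, measure_biUnion_finset (fun i _ j _ hij => hd hij) fun i _ => hE i,
      measure_biUnion_finset
        (fun i _ j _ hij => (hd hij).mono Set.inter_subset_left Set.inter_subset_left)
        fun i _ => (hE i).inter hA, Finset.mul_sum]
    refine Finset.sum_le_sum fun i hi => ?_
    rw [← cond_mul_eq_inter (hE i)]
    gcongr
    exact ha i hi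
  rw [← cond_mul_eq_inter hm] at h1
  exact (ENNReal.mul_le_mul_iff_left hne (measure_ne_top P _)).1 h1

lemma cond_pi_univ_pi {ι : Type*} [Fintype ι] {α : ι → Type*} [∀ i, MeasurableSpace (α i)]
    (μ : ∀ i, Measure (α i)) [∀ i, IsProbabilityMeasure (μ i)] {s : ∀ i, Set (α i)}
    (hs : ∀ i, MeasurableSet (s i)) (h0 : ∀ i, μ i (s i) ≠ 0) :
    (Measure.pi μ)[|Set.univ.pi s] = Measure.pi fun i => (μ i)[|s i] := by
  have : ∀ i, IsProbabilityMeasure ((μ i)[|s i]) := fun i => cond_isProbabilityMeasure (h0 i)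
  refine (Measure.pi_eq fun t ht => ?_).symm
  rw [cond_apply (MeasurableSet.univ_pi hs), ← Set.pi_inter_distrib, Measure.pi_pi,
    Measure.pi_pi, ENNReal.prod_inv_distrib, ← Finset.prod_mul_distrib]
  · exact Finset.prod_congr rfl fun i _ => (cond_apply (hs i) _ _).symm
  · exact fun i _ j _ _ => Or.inl (h0 i)

lemma exists_balanced_labels {m : ℕ} (hC : C ∣ m) :
    ∃ c : Fin m → Fin C, ∀ k, C * (Finset.univ.filter fun i => c i = k).card = m := by
  obtain ⟨q, rfl⟩ := hC
  rw [mul_comm]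
  refine ⟨fun i => (finProdFinEquiv.symm i).2, fun k => ?_⟩
  have h1 : (Finset.univ.filter fun i : Fin (q * C) => (finProdFinEquiv.symm i).2 = k).card =
      (Finset.univ.filter fun p : Fin q × Fin C => p.2 = k).card := by
    refine Finset.card_equiv finProdFinEquiv.symm fun i => ?_
    simp
  have h2 : (Finset.univ.filter fun p : Fin q × Fin C => p.2 = k) =
      Finset.univ ×ˢ {k} := by
    ext p
    simp only [Finset.mem_filter, Finset.mem_univ, true_and, Finset.mem_product,
      Finset.mem_singleton]
  rw [h1, h2, Finset.card_product]
  simp [mul_comm]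

/-- The data points with Bayes optimal label `k`. -/
def classSet (p : ℕ) (k : Fin C) : Set (DataPoint p C) := {z | z.2.2 = k}

lemma measurableSet_classSet (p : ℕ) (k : Fin C) : MeasurableSet (classSet p k) :=
  (measurable_snd.comp measurable_snd) (measurableSet_singleton k)

/-- Conditioning on a class of mass `1/C` multiplies the integral over it by `C`, and each class
occurs `m/C` times; the classes partition the space. -/
lemma sum_integral_cond_classSet {p m : ℕ} (D : Measure (DataPoint p C))
    [IsProbabilityMeasure D] (hD : ∀ k : Fin C, D (classSet p k) = (C : ℝ≥0∞)⁻¹)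
    {c : Fin m → Fin C} (hc : ∀ k, C * (Finset.univ.filter fun i => c i = k).card = m)
    {g : DataPoint p C → ℝ} (hg : Integrable g D) :
    ∑ i, ∫ z, g z ∂D[|classSet p (c i)] = m * ∫ z, g z ∂D := by
  have hint : ∀ k, ∫ z, g z ∂D[|classSet p k] = C * ∫ z in classSet p k, g z ∂D := by
    intro k
    rw [ProbabilityTheory.cond, integral_smul_measure, hD]
    simp
  have hsplit : ∑ k, ∫ z in classSet p k, g z ∂D = ∫ z, g z ∂D := by
    rw [← integral_iUnion_fintype (fun k => measurableSet_classSet p k)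
      (fun k k' hkk' => Set.disjoint_left.2 fun z hz hz' => hkk' (hz.symm.trans hz'))
      fun k => hg.integrableOn]
    have : ⋃ k, classSet p k = (Set.univ : Set (DataPoint p C)) :=
      Set.eq_univ_of_forall fun z => Set.mem_iUnion.2 ⟨z.2.2, rfl⟩
    rw [this, setIntegral_univ]
  simp only [hint]
  rw [← hsplit, Finset.mul_sum,
    ← Finset.sum_fiberwise (s := Finset.univ) (g := c)]
  refine Finset.sum_congr rfl fun k _ => ?_
  rw [Finset.sum_congr rfl (g := fun _ => (C : ℝ) * ∫ z in classSet p k, g z ∂D)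
    fun i hi => by rw [(Finset.mem_filter.1 hi).2]]
  rw [Finset.sum_const, nsmul_eq_mul, ← mul_assoc, mul_comm _ (C : ℝ)]
  congr 1
  exact_mod_cast hc k

lemma setOf_classBalanced_eq {p m : ℕ} :
    {S : Fin m → DataPoint p C | ClassBalanced S} =
      ⋃ c ∈ Finset.univ.filter fun c : Fin m → Fin C =>
        ∀ k, C * (Finset.univ.filter fun i => c i = k).card = m,
      Set.univ.pi fun i => classSet p (c i) := by
  ext S
  simp only [Set.mem_iUnion, Finset.mem_filter, Finset.mem_univ, true_and, Set.mem_pi,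
    Set.mem_univ, forall_true_left, exists_prop]
  constructor
  · exact fun hS => ⟨fun i => (S i).2.2, hS, fun i => rfl⟩
  · rintro ⟨c, hc, hS⟩
    have : c = fun i => (S i).2.2 := funext fun i => (hS i).symm
    subst this
    exact hc

end Crowds

theorem theorem1
    -- number of classes, of hidden layers (so that there are `L + 1` layers), layer widths
    (C L : ℕ) (h : ℕ → ℕ)
    -- activation functions: 1-Lipschitz and positive-homogeneous
    (σ : Fin L → ℝ → ℝ)
    (hσ_lip : ∀ i, LipschitzWith 1 (σ i))
    (hσ_hom : ∀ i, ∀ a : ℝ, 0 < a → ∀ u : ℝ, σ i (a * u) = a * σ i u)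
    -- the instance space, bounded by `B`
    (X : Set (EuclideanSpace ℝ (Fin (h 0)))) (B : ℝ) (hB : ∀ x ∈ X, ‖x‖ ≤ B)
    -- the Frobenius bounds, and the bound `M` on the loss
    (Mw : Fin (L + 1) → ℝ) (M : ℝ)
    (hM : ∀ W : Crowds.Weights C L h, W.FrobeniusBounded Mw →
      ∀ x ∈ X, ∀ ybar ystar : Fin C, W.loss σ (x, ybar, ystar) ≤ M)
    -- the annotators, the distributions of their data points, the sizes of their distilled sets
    (R : ℕ) (D : Fin R → Measure (Crowds.DataPoint (h 0) C)) [∀ j, IsProbabilityMeasure (D j)]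
    (hD : ∀ j, ∀ᵐ z ∂(D j), z.1 ∈ X)
    (m : Fin R → ℕ) (hm : ∀ j, 0 < m j)
    (j : Fin R) (δ : ℝ) (hδ : δ ∈ Set.Ioo (0 : ℝ) 1) :
    -- an i.i.d. distilled set
    ENNReal.ofReal (1 - δ) ≤ Measure.pi (fun _ : Fin (m j) => D j)
      {S | ∀ W : Crowds.Weights C L h, W.FrobeniusBounded Mw →
        W.risk σ (D j) - W.empiricalRisk σ S ≤ Crowds.genBound C B Mw M (m j) δ} ∧
    -- a distilled set that is conditioned to be class-balanced, classes being equally likely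
    (C ∣ m j → (∀ k : Fin C, D j {z | z.2.2 = k} = (C : ℝ≥0∞)⁻¹) →
      ENNReal.ofReal (1 - δ) ≤
        (Measure.pi (fun _ : Fin (m j) => D j))[|{S | Crowds.ClassBalanced S}]
        {S | ∀ W : Crowds.Weights C L h, W.FrobeniusBounded Mw →
          W.risk σ (D j) - W.empiricalRisk σ S ≤ Crowds.genBound C B Mw M (m j) δ}) := by
  have hσ : ∀ i, Continuous (σ i) := fun i => (hσ_lip i).continuous
  have hMae : ∀ W : Crowds.Weights C L h, W.FrobeniusBounded Mw →
      ∀ᵐ z ∂(D j), W.loss σ z ≤ M := fun W hW =>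
    (hD j).mono fun z hz => hM W hW _ hz _ _
  have ha : ENNReal.ofReal (1 - δ) ≤ 1 := by
    rw [ENNReal.ofReal_le_one]
    linarith [hδ.1]
  constructor
  · refine Crowds.le_measure_forall_risk_sub_le hσ (D j) hMae _ ha fun n u hu => ?_
    exact Crowds.le_pi_forall_risk_sub_le hσ_lip hσ_hom hB hM (hm j) (D j) (fun _ => D j)
      (fun _ => hD j) (fun W _ => by simp [Crowds.Weights.risk]) hδ u hu
  · intro hdvd hunif
    have hk0 : ∀ k : Fin C, D j (Crowds.classSet (h 0) k) ≠ 0 := fun k => by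
      have := hunif k
      change D j (Crowds.classSet (h 0) k) = _ at this
      simp [this]
    have hbox : ∀ c : Fin (m j) → Fin C,
        MeasurableSet (Set.univ.pi fun i => Crowds.classSet (h 0) (c i)) := fun c =>
      MeasurableSet.univ_pi fun i => Crowds.measurableSet_classSet _ _
    -- A balanced labelling exists as `C ∣ m j`, and its box has positive measure; conditioning on a
    -- null event would not give a probability measure.
    have hne : Measure.pi (fun _ : Fin (m j) => D j)
        {S : Fin (m j) → Crowds.DataPoint (h 0) C | Crowds.ClassBalanced S} ≠ 0 := by
      obtain ⟨c, hc⟩ := Crowds.exists_balanced_labels hdvd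
      refine ne_of_gt (lt_of_lt_of_le ?_ (measure_mono
        (s := Set.univ.pi fun i => Crowds.classSet (h 0) (c i)) fun S hS => ?_))
      · rw [Measure.pi_pi]
        exact pos_iff_ne_zero.2 (Finset.prod_ne_zero_iff.2 fun i _ => hk0 (c i))
      · rw [Crowds.setOf_classBalanced_eq]
        exact Set.mem_biUnion (Finset.mem_filter.2 ⟨Finset.mem_univ c, hc⟩) hS
    have : IsProbabilityMeasure ((Measure.pi (fun _ : Fin (m j) => D j))[|{S |
        Crowds.ClassBalanced S}]) := cond_isProbabilityMeasure hne
    refine Crowds.le_measure_forall_risk_sub_le hσ (D j) hMae _ ha fun n u hu => ?_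
    -- The balanced event is the disjoint union of the boxes of balanced labellings. Conditioned on
    -- one box the sample is a product of class-conditional laws, so the bound on every box gives it
    -- on the union.
    rw [Crowds.setOf_classBalanced_eq] at hne ⊢
    refine Crowds.le_cond_biUnion _ _ hbox ?_ ?_ (fun c hc => ?_) hne
    · intro c c' hcc'
      refine Set.disjoint_left.2 fun S hS hS' => hcc' (funext fun i => ?_)
      exact (hS i trivial).symm.trans (hS' i trivial)
    · simp only [Set.ofPred_forall]
      exact MeasurableSet.iInter fun k => measurableSet_le
        (measurable_const.sub ((u k).measurable_empiricalRisk hσ _)) measurable_const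
    · rw [Crowds.cond_pi_univ_pi _ (fun i => Crowds.measurableSet_classSet _ _)
        fun i => hk0 (c i)]
      have : ∀ i, IsProbabilityMeasure ((D j)[|Crowds.classSet (h 0) (c i)]) := fun i =>
        cond_isProbabilityMeasure (hk0 (c i))
      refine Crowds.le_pi_forall_risk_sub_le hσ_lip hσ_hom hB hM (hm j) (D j) _
        (fun i => cond_absolutelyContinuous.ae_le (hD j)) (fun W hW => ?_) hδ u hu
      refine Crowds.sum_integral_cond_classSet (D j) hunif (Finset.mem_filter.1 hc).2 ?_
      refine Integrable.of_bound (W.measurable_loss hσ).aestronglyMeasurable M ?_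
      filter_upwards [hMae W hW] with z hz
      rwa [Real.norm_of_nonneg (Crowds.Weights.loss_nonneg _ _ _)]
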